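/- Let $d\ge 2$. Let $A(d,1)$ be the space of bi-infinite straight lines in $\mathbb{R}^d$, with the $\sigma$-algebra generated by the sets $\mathcal{L}_K=\{L: L\cap K\neq\emptyset\}$, $K\subset\mathbb{R}^d$ compact, and let $\mu_{d,1}$ be the measure on $A(d,1)$ that is invariant under rotations, reflections and translations, normalized so that the set of lines meeting the closed unit ball has measure $1$; explicitly, $$\mu_{d,1}(S)=\frac1{\kappa_{d-1}}\int_{S^{d-1}}\lambda_{d-1}\big(\{y\in u^{\perp}: y+\mathbb{R}u\in S\}\big)\,\sigma(du),$$ where $\sigma$ is the uniform probability measure on the unit sphere, $\lambda_{d-1}$ is Lebesgue measure on the hyperplane $u^\perp$ and $\kappa_{d-1}$ is the volume of the unit ball in $\mathbb{R}^{d-1}$. Let $\Psi$ be a Poisson point process on $A(d,1)\times[0,\infty)$ whose intensity measure is the product of $\mu_{d,1}$ and Lebesgue measure. For a line $L$ let $\mathfrak{c}(L)=\{x\in\mathbb{R}^d: \mathrm{dist}(x,L)\le 1\}$. Fix $\rho$ with $$0<\rho<\min\Big(\frac{d-1}{6d},\frac{C_d}{5}\Big),\qquad C_d=\sqrt{1-4^{-1/(d-2)}}\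 \text{ for } d\ge 3,\quad C_2=1.$$ Fix any rule which assigns to each bounded set $A\subset\mathbb{R}^d$ a subset $A^\rho\subset A$ whose distinct points are at distance at least $\rho$ from each other and which has the largest possible number $|A^\rho|$ of points among such subsets. Define the discrete cover time $$T_d^\rho(A)=\inf\Big\{t>0: A^\rho\subset\bigcup_{(L,s)\in\Psi,\ s\le t}\mathfrak{c}(L)\Big\}.$$ **Theorem.** Let $(A_n)$ be a sequence of bounded subsets of $\mathbb{R}^d$ with $|A_n^\rho|\to\infty$ as $n\to\infty$. Then each $T_d^\rho(A_n)$ is almost surely finite, and $T_d^\rho(A_n)-\log|A_n^\rho|$ converges in distribution, as $n\to\infty$, to the standard Gumbel law, i.e. the law with distribution function $z\mapsto\exp(-e^{-z})$. -/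

import Mathlib

open MeasureTheory ProbabilityTheory Filter Topology Metric Set
open scoped ENNReal NNReal RealInnerProductSpace

noncomputable section

namespace PoissonCylinder

/-- Euclidean space `ℝ^d`. -/
abbrev Space (d : ℕ) : Type := EuclideanSpace ℝ (Fin d)

/-! ### The space of lines and its invariant measure -/

/-- The affine Grassmannian `A(d,1)`: all bi-infinite straight lines in `ℝ^d`
(not necessarily through the origin), i.e. the one-dimensional affine subspaces. -/
def Line (d : ℕ) : Type :=
  {L : AffineSubspace ℝ (Space d) // Module.finrank ℝ L.direction = 1}

/-- The set of points on a line. -/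
def Line.carrier {d : ℕ} (L : Line d) : Set (Space d) := (L.1 : Set (Space d))

/-- `𝓛_K`, the set of lines that meet `K`. -/
def hitting {d : ℕ} (K : Set (Space d)) : Set (Line d) := {L | (L.carrier ∩ K).Nonempty}

/-- The usual (Fell) σ-algebra on the space of lines: it is generated by the sets `𝓛_K`,
`K` compact. -/
instance instMeasurableSpaceLine (d : ℕ) : MeasurableSpace (Line d) :=
  MeasurableSpace.generateFrom {S | ∃ K : Set (Space d), IsCompact K ∧ S = hitting K}

/-- The unit sphere of `ℝ^d`. A unit vector `u` represents the line `ℝ u ∈ G(d,1)`. -/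
abbrev UnitSphere (d : ℕ) : Type := sphere (0 : Space d) 1

/-- The line `y + ℝ u`. -/
def lineThrough {d : ℕ} (u : UnitSphere d) (y : Space d) : Line d :=
  ⟨AffineSubspace.mk' y (ℝ ∙ (u : Space d)), by
    rw [AffineSubspace.direction_mk']
    exact finrank_span_singleton (ne_zero_of_mem_unit_sphere u)⟩

/-- The uniform probability measure on the unit sphere. Its image under `u ↦ ℝ u` is the
normalized rotation invariant measure `ν_{d,1}` on `G(d,1)`. -/
def directionMeasure (d : ℕ) : Measure (UnitSphere d) :=
  ((volume : Measure (Space d)).toSphere univ)⁻¹ • (volume : Measure (Space d)).toSphere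

/-- For a direction `u`, the image of Lebesgue measure on the hyperplane `u^⊥` under
`y ↦ y + ℝ u`: a measure on the set of lines parallel to `u`. -/
def parallelMeasure {d : ℕ} (u : UnitSphere d) : Measure (Line d) :=
  (volume : Measure (ℝ ∙ (u : Space d))ᗮ).map
    fun y : (ℝ ∙ (u : Space d))ᗮ => lineThrough u (y : Space d)

/-- The invariant measure `μ_{d,1}` on the space of lines, normalized so that the lines meeting
the closed unit ball have measure one:
`μ_{d,1}(S) = κ_{d-1}⁻¹ ∫_{G(d,1)} λ_{d-1}({y ∈ u^⊥ | y + ℝ u ∈ S}) ν_{d,1}(du)`,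
with `κ_{d-1}` the volume of the unit ball of `ℝ^{d-1}`
(see `lineMeasure_apply`). -/
def lineMeasure (d : ℕ) : Measure (Line d) :=
  (volume (closedBall (0 : Space (d - 1)) 1))⁻¹ • (directionMeasure d).bind parallelMeasure

section measurability

variable {d : ℕ}

lemma lineThrough_mem_hitting {u : UnitSphere d} {y : Space d} {K : Set (Space d)} :
    lineThrough u y ∈ hitting K ↔ ∃ x ∈ K, x - y = ⟪(u : Space d), x - y⟫ • (u : Space d) := by
  have hu : ⟪(u : Space d), (u : Space d)⟫ = 1 := by
    rw [real_inner_self_eq_norm_sq, norm_eq_of_mem_sphere]; norm_num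
  constructor
  · rintro ⟨x, hx, hK⟩
    refine ⟨x, hK, ?_⟩
    have hx' : x ∈ AffineSubspace.mk' y (ℝ ∙ (u : Space d)) := hx
    rw [AffineSubspace.mem_mk', vsub_eq_sub, Submodule.mem_span_singleton] at hx'
    obtain ⟨a, ha⟩ := hx'
    rw [← ha, inner_smul_right, hu, mul_one]
  · rintro ⟨x, hK, hx⟩
    refine ⟨x, ?_, hK⟩
    change x ∈ AffineSubspace.mk' y (ℝ ∙ (u : Space d))
    rw [AffineSubspace.mem_mk', vsub_eq_sub, Submodule.mem_span_singleton]
    exact ⟨_, hx.symm⟩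

lemma measurable_lineThrough :
    Measurable fun p : UnitSphere d × Space d => lineThrough p.1 p.2 := by
  refine measurable_generateFrom ?_
  rintro S ⟨K, hK, rfl⟩
  have : CompactSpace K := isCompact_iff_compactSpace.mp hK
  let C : Set ((UnitSphere d × Space d) × K) :=
    {q | (q.2 : Space d) - q.1.2
      = ⟪(q.1.1 : Space d), (q.2 : Space d) - q.1.2⟫ • (q.1.1 : Space d)}
  have hC : IsClosed C := by
    refine isClosed_eq ?_ ?_ <;> fun_prop
  have h : (fun p : UnitSphere d × Space d => lineThrough p.1 p.2) ⁻¹' hitting K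
      = Prod.fst '' C := by
    ext p
    rw [mem_preimage, lineThrough_mem_hitting]
    constructor
    · rintro ⟨x, hx, h⟩
      exact ⟨(p, ⟨x, hx⟩), h, rfl⟩
    · rintro ⟨⟨q, x⟩, h, rfl⟩
      exact ⟨x, x.2, h⟩
  rw [h]
  exact (isClosedMap_fst_of_compactSpace _ hC).measurableSet

lemma measurable_lineThrough_right (u : UnitSphere d) :
    Measurable fun y : (ℝ ∙ (u : Space d))ᗮ => lineThrough u (y : Space d) := by
  have h : Measurable fun y : (ℝ ∙ (u : Space d))ᗮ => (u, (y : Space d)) :=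
    measurable_const.prodMk measurable_subtype_coe
  have h2 := Measurable.comp (g := fun p : UnitSphere d × Space d => lineThrough p.1 p.2)
    measurable_lineThrough h
  exact h2

lemma parallelMeasure_apply (u : UnitSphere d) {S : Set (Line d)} (hS : MeasurableSet S) :
    parallelMeasure u S
      = volume {y : (ℝ ∙ (u : Space d))ᗮ | lineThrough u (y : Space d) ∈ S} :=
  Measure.map_apply (measurable_lineThrough_right u) hS

lemma lineThrough_orthogonalProjection (u : UnitSphere d) (x : Space d) :
    lineThrough u (((ℝ ∙ (u : Space d))ᗮ.orthogonalProjectionOnto x : _) : Space d)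
      = lineThrough u x := by
  have hx : (((ℝ ∙ (u : Space d)).orthogonalProjectionOnto x : _) : Space d)
      + (((ℝ ∙ (u : Space d))ᗮ.orthogonalProjectionOnto x : _) : Space d) = x := by
    simp
  set a := ((ℝ ∙ (u : Space d)).orthogonalProjectionOnto x)
  set b := ((ℝ ∙ (u : Space d))ᗮ.orthogonalProjectionOnto x)
  apply Subtype.ext
  change AffineSubspace.mk' (b : Space d) (ℝ ∙ (u : Space d))
    = AffineSubspace.mk' x (ℝ ∙ (u : Space d))
  have hmem : x ∈ AffineSubspace.mk' (b : Space d) (ℝ ∙ (u : Space d)) := by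
    rw [AffineSubspace.mem_mk', vsub_eq_sub, ← hx, add_sub_cancel_right]
    exact a.2
  have := AffineSubspace.mk'_eq hmem
  rw [AffineSubspace.direction_mk'] at this
  exact this.symm

/-- Lebesgue measure on `u^⊥` as Lebesgue measure on a slab of unit width. -/
lemma parallelMeasure_apply_slab (u : UnitSphere d) {S : Set (Line d)} (hS : MeasurableSet S) :
    parallelMeasure u S
      = volume {x : Space d | ⟪(u : Space d), x⟫ ∈ Ico (0 : ℝ) 1 ∧ lineThrough u x ∈ S} := by
  rw [parallelMeasure_apply u hS]
  have hnorm : ‖(u : Space d)‖ = 1 := norm_eq_of_mem_sphere u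
  have hmp : MeasurePreserving
      (fun x : Space d => ((ℝ ∙ (u : Space d)).orthogonalProjectionOnto x,
        (ℝ ∙ (u : Space d))ᗮ.orthogonalProjectionOnto x)) volume volume := by
    have h := (WithLp.volume_preserving_ofLp (ℝ ∙ (u : Space d)) (ℝ ∙ (u : Space d))ᗮ).comp
      (ℝ ∙ (u : Space d)).orthogonalDecomposition.measurePreserving
    have he : (fun x : Space d => ((ℝ ∙ (u : Space d)).orthogonalProjectionOnto x,
        (ℝ ∙ (u : Space d))ᗮ.orthogonalProjectionOnto x))
        = WithLp.ofLp ∘ (ℝ ∙ (u : Space d)).orthogonalDecomposition := by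
      funext x
      simp
    rw [he]
    exact h
  have hI : MeasurableSet {z : (ℝ ∙ (u : Space d)) | ⟪(u : Space d), (z : Space d)⟫ ∈
      Ico (0 : ℝ) 1} := by
    have hc : Continuous fun z : (ℝ ∙ (u : Space d)) => ⟪(u : Space d), (z : Space d)⟫ := by
      fun_prop
    exact hc.measurable measurableSet_Ico
  have hB : MeasurableSet {y : (ℝ ∙ (u : Space d))ᗮ | lineThrough u (y : Space d) ∈ S} :=
    measurable_lineThrough_right u hS
  have hone : volume {z : (ℝ ∙ (u : Space d)) | ⟪(u : Space d), (z : Space d)⟫ ∈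
      Ico (0 : ℝ) 1} = 1 := by
    rw [← (LinearIsometryEquiv.toSpanUnitSingleton (u : Space d)
      hnorm).measurePreserving.measure_preimage hI.nullMeasurableSet]
    have : (LinearIsometryEquiv.toSpanUnitSingleton (u : Space d) hnorm) ⁻¹'
        {z : (ℝ ∙ (u : Space d)) | ⟪(u : Space d), (z : Space d)⟫ ∈ Ico (0 : ℝ) 1}
        = Ico (0 : ℝ) 1 := by
      ext r
      simp [inner_smul_right, hnorm]
    rw [this]
    simp
  have hpre : {x : Space d | ⟪(u : Space d), x⟫ ∈ Ico (0 : ℝ) 1 ∧ lineThrough u x ∈ S}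
      = (fun x : Space d => ((ℝ ∙ (u : Space d)).orthogonalProjectionOnto x,
        (ℝ ∙ (u : Space d))ᗮ.orthogonalProjectionOnto x)) ⁻¹'
        ({z : (ℝ ∙ (u : Space d)) | ⟪(u : Space d), (z : Space d)⟫ ∈ Ico (0 : ℝ) 1} ×ˢ
          {y : (ℝ ∙ (u : Space d))ᗮ | lineThrough u (y : Space d) ∈ S}) := by
    ext x
    have hin : ⟪(u : Space d), ((ℝ ∙ (u : Space d)).orthogonalProjectionOnto x : Space d)⟫
        = ⟪(u : Space d), x⟫ := by
      have h0 : ⟪(u : Space d), ((ℝ ∙ (u : Space d))ᗮ.orthogonalProjectionOnto x : Space d)⟫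
          = 0 := (Submodule.mem_orthogonal_singleton_iff_inner_right.mp
            ((ℝ ∙ (u : Space d))ᗮ.orthogonalProjectionOnto x).2)
      have hx : (((ℝ ∙ (u : Space d)).orthogonalProjectionOnto x : _) : Space d)
          + (((ℝ ∙ (u : Space d))ᗮ.orthogonalProjectionOnto x : _) : Space d) = x := by
        simp
      conv_rhs => rw [← hx, inner_add_right, h0, add_zero]
    simp only [mem_ofPred_eq, mem_preimage, mem_prod, lineThrough_orthogonalProjection, hin]
  rw [hpre, hmp.measure_preimage (hI.prod hB).nullMeasurableSet, Measure.volume_eq_prod,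
    Measure.prod_prod, hone, one_mul]

lemma measurable_parallelMeasure :
    Measurable (parallelMeasure : UnitSphere d → Measure (Line d)) := by
  refine Measure.measurable_of_measurable_coe _ fun S hS => ?_
  simp_rw [parallelMeasure_apply_slab _ hS]
  have hT : MeasurableSet {p : UnitSphere d × Space d |
      ⟪(p.1 : Space d), p.2⟫ ∈ Ico (0 : ℝ) 1 ∧ lineThrough p.1 p.2 ∈ S} := by
    refine MeasurableSet.inter ?_ (measurable_lineThrough hS)
    have hc : Continuous fun p : UnitSphere d × Space d => ⟪(p.1 : Space d), p.2⟫ := by fun_prop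
    exact hc.measurable measurableSet_Ico
  exact measurable_measure_prodMk_left hT

/-- The representation formula of the invariant measure on lines. -/
lemma lineMeasure_apply {S : Set (Line d)} (hS : MeasurableSet S) :
    lineMeasure d S = (volume (closedBall (0 : Space (d - 1)) 1))⁻¹ *
      ∫⁻ u, volume {y : (ℝ ∙ (u : Space d))ᗮ | lineThrough u (y : Space d) ∈ S}
        ∂(directionMeasure d) := by
  rw [lineMeasure, Measure.smul_apply, smul_eq_mul,
    Measure.bind_apply hS measurable_parallelMeasure.aemeasurable]
  simp_rw [parallelMeasure_apply _ hS]

end measurability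

/-! ### Poisson processes and the cylinder process -/

/-- A Poisson (point) process on `E` with diffuse σ-finite intensity measure `Λ`, seen as a random
set of points `Ψ ω ⊆ E`: the number of points in a measurable set is a random variable, which has
the Poisson law of mean `Λ B` when `Λ B < ∞`, and the numbers of points in pairwise disjoint
measurable sets are independent. -/
structure IsPoissonProcess {Ω E : Type*} [MeasurableSpace Ω] [MeasurableSpace E]
    (Ψ : Ω → Set E) (Λ : Measure E) (P : Measure Ω) : Prop where
  measurable_count : ∀ B : Set E, MeasurableSet B → Measurable fun ω => (Ψ ω ∩ B).encard
  map_count : ∀ B : Set E, MeasurableSet B → Λ B < ∞ →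
    P.map (fun ω => (Ψ ω ∩ B).encard)
      = (poissonMeasure (Λ B).toNNReal).map (fun k : ℕ => (k : ℕ∞))
  indep_count : ∀ (m : ℕ) (B : Fin m → Set E), (∀ i, MeasurableSet (B i)) →
    Pairwise (fun i j => Disjoint (B i) (B j)) →
    iIndepFun (fun i ω => (Ψ ω ∩ B i).encard) P

/-- Lebesgue measure on `ℝ⁺ = [0, ∞)`. -/
def timeMeasure : Measure ℝ≥0 := (volume : Measure ℝ).comap ((↑) : ℝ≥0 → ℝ)

/-- `Ψ` is a Poisson process of lines with time stamps: a Poisson process on `A(d,1) × ℝ⁺` with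
intensity measure `μ_{d,1} × λ⁺`. -/
def IsCylinderProcess {Ω : Type*} [MeasurableSpace Ω] {d : ℕ} (Ψ : Ω → Set (Line d × ℝ≥0))
    (P : Measure Ω) : Prop :=
  IsPoissonProcess Ψ ((lineMeasure d).prod timeMeasure) P

/-- The closed cylinder of radius one around a line. -/
def cylinder {d : ℕ} (L : Line d) : Set (Space d) := {x | infDist x L.carrier ≤ 1}

/-- The time `inf {t > 0 | A ⊆ ⋃_{(L,s) ∈ ψ, s ≤ t} cylinder L}` at which `A` is covered by the
cylinders of the configuration `ψ`, with value `∞` if `A` is never covered. -/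
def coverTime {d : ℕ} (ψ : Set (Line d × ℝ≥0)) (A : Set (Space d)) : ℝ≥0∞ :=
  ⨅ (t : ℝ≥0) (_ : 0 < t) (_ : A ⊆ ⋃ p ∈ {p ∈ ψ | p.2 ≤ t}, cylinder p.1), (t : ℝ≥0∞)

/-! ### Maximal separated subsets -/

/-- `S` is a `ρ`-separated subset of `A`. -/
def IsSeparatedIn {d : ℕ} (ρ : ℝ) (A : Set (Space d)) (S : Finset (Space d)) : Prop :=
  (S : Set (Space d)) ⊆ A ∧ ∀ x ∈ S, ∀ y ∈ S, x ≠ y → ρ ≤ dist x y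

/-- A rule `R` which picks, for every bounded set `A`, one `ρ`-separated subset `A^ρ = R A` of `A`
with the maximal number of points. -/
def IsSelectionRule {d : ℕ} (ρ : ℝ) (R : Set (Space d) → Finset (Space d)) : Prop :=
  ∀ A : Set (Space d), Bornology.IsBounded A →
    IsSeparatedIn ρ A (R A) ∧ ∀ S, IsSeparatedIn ρ A S → S.card ≤ (R A).card

/-- The discrete cover time `T_d^ρ(A)`: the cover time of `A^ρ = R A`. -/
def discreteCoverTime {d : ℕ} (R : Set (Space d) → Finset (Space d))
    (ψ : Set (Line d × ℝ≥0)) (A : Set (Space d)) : ℝ≥0∞ :=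
  coverTime ψ (R A : Set (Space d))

/-! ### The constant and the limit law -/

/-- `C_d = √(1 - 4^{-1/(d-2)})` for `d > 2`, and `C_2 = 1`. -/
def constC (d : ℕ) : ℝ :=
  if d = 2 then 1 else √(1 - (4 : ℝ) ^ (-1 / ((d : ℝ) - 2)))

/-- The distribution function `z ↦ exp (-exp (-z))` of the standard Gumbel law. -/
def gumbelCDF : StieltjesFunction ℝ where
  toFun z := Real.exp (-Real.exp (-z))
  mono' := by
    intro a b h
    simpa using h
  right_continuous' := fun z => by
    have h : Continuous fun z : ℝ => Real.exp (-Real.exp (-z)) := by fun_prop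
    exact h.continuousWithinAt

/-- The standard Gumbel law. -/
def gumbel : Measure ℝ := gumbelCDF.measure

instance isProbabilityMeasure_gumbel : IsProbabilityMeasure gumbel := by
  refine gumbelCDF.isProbabilityMeasure ?_ ?_
  · exact Real.tendsto_exp_atBot.comp (tendsto_neg_atTop_atBot.comp
      (Real.tendsto_exp_atTop.comp tendsto_neg_atBot_atTop))
  · have h : Tendsto (fun z : ℝ => Real.exp (-Real.exp (-z))) atTop (𝓝 (Real.exp (-0))) :=
      (Real.continuous_exp.tendsto _).comp
        ((Real.tendsto_exp_atBot.comp tendsto_neg_atTop_atBot).neg)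
    rw [neg_zero, Real.exp_zero] at h
    exact h

end PoissonCylinder

end

noncomputable section
namespace PoissonCylinder

/-! A point is uncovered at time `t` exactly when no line with stamp at most `t` meets the unit ball
around it. So all points of a finite set `T` are uncovered with probability `exp (-t m(T))`, where
`m(T)` is the invariant measure of the lines meeting one of the unit balls around `T`
(`measureReal_iInter_void`). One ball has measure one. With `N` points and `t = log N + z`, the
expected number of uncovered points is therefore `e^{-z}`, and the claim is that this number has the
void probability of a Poisson variable of that mean.

The method is that of binomial moments. By `bonferroni` and `tendsto_exp_neg_of_binomial_moments` it
suffices that for every `k` the sum of `exp (-t m(T))` over all `k`-subsets `T` tends to `e^{-zk} /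
k!`. Since `m(T) ≤ k`, the lower bound is immediate. The upper bound rests on two geometric facts.
Lines meeting two balls are rare when the centres are far apart (`exists_lineMeasure_inter_le`), and
two balls whose centres are at distance at least `ρ` differ by a fixed amount of measure
(`exists_le_lineMeasure_diff`).

Take the scale `D = (log N)^2`. If `T` is `D`-separated, then `m(T) ≥ k - O(1/D)`, and the error
vanishes because `t / D → 0`. Otherwise `T` lies near a maximal `D`-separated subset `U` of size `c
< k`, and some further point raises the measure to `c + ε - O(1/D)`. There are at most `N^c` choices
of `U`, and by packing only polylogarithmically many `T` near each, so these sets contribute at most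
a power of `log N` times `N^{-ε}` (`sum_not_separated_le`). -/

/-! ### Bonferroni inequalities, binomial moments and weak convergence -/

lemma abs_ite_sub_sum_choose_le (n K : ℕ) :
    |(if n = 0 then (1 : ℝ) else 0) - ∑ k ∈ Finset.range K, (-1 : ℝ) ^ k * n.choose k|
      ≤ n.choose K := by
  rcases n with _ | n
  · rcases K with _ | K
    · simp
    · rw [Finset.sum_range_succ']
      simp
  · rcases K with _ | K
    · simp
    · have h := congrArg (Int.cast : ℤ → ℝ)
        (Int.alternating_sum_range_choose_eq_choose (n := n) (m := K))
      push_cast at h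
      rw [if_neg (Nat.succ_ne_zero n), h, zero_sub, abs_neg, abs_mul, abs_pow, abs_neg, abs_one,
        one_pow, one_mul, Nat.abs_cast]
      exact_mod_cast Nat.choose_succ_succ n K ▸ Nat.le_add_right _ _

/-- Bonferroni's inequalities, in a two-sided form. -/
lemma bonferroni {Ω ι : Type*} [MeasurableSpace Ω] (P : Measure Ω) [IsProbabilityMeasure P]
    (s : Finset ι) (E : ι → Set Ω) (hE : ∀ i ∈ s, MeasurableSet (E i)) (K : ℕ) :
    |P.real (⋂ i ∈ s, (E i)ᶜ) - ∑ k ∈ Finset.range K, (-1 : ℝ) ^ k *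
        ∑ T ∈ s.powersetCard k, P.real (⋂ i ∈ T, E i)|
      ≤ ∑ T ∈ s.powersetCard K, P.real (⋂ i ∈ T, E i) := by
  classical
  let X : Ω → ℕ := fun ω => (s.filter fun i => ω ∈ E i).card
  have hmeas : ∀ k, ∀ T ∈ s.powersetCard k, MeasurableSet (⋂ i ∈ T, E i) := fun k T hT =>
    Finset.measurableSet_biInter _ fun i hi => hE i ((Finset.mem_powersetCard.1 hT).1 hi)
  have hmeas0 : MeasurableSet (⋂ i ∈ s, (E i)ᶜ) :=
    Finset.measurableSet_biInter _ fun i hi => (hE i hi).compl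
  -- `(X ω).choose k` counts the `k`-sets of events that all occur at `ω`, so integrating the
  -- pointwise estimate for `X` gives the claim.
  have hchoose : ∀ k ω, ((X ω).choose k : ℝ)
      = ∑ T ∈ s.powersetCard k, (⋂ i ∈ T, E i).indicator (1 : Ω → ℝ) ω := by
    intro k ω
    have : (s.filter fun i => ω ∈ E i).powersetCard k
        = (s.powersetCard k).filter fun T => ω ∈ ⋂ i ∈ T, E i := by
      ext T
      simp only [Finset.mem_powersetCard, Finset.mem_filter, mem_iInter, Finset.subset_iff]
      grind
    rw [← Finset.card_powersetCard, this, Finset.card_filter]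
    push_cast
    exact Finset.sum_congr rfl fun T _ => by simp [indicator_apply]
  have hzero : ∀ ω, (if X ω = 0 then (1 : ℝ) else 0)
      = (⋂ i ∈ s, (E i)ᶜ).indicator (1 : Ω → ℝ) ω := by
    intro ω
    have : X ω = 0 ↔ ω ∈ ⋂ i ∈ s, (E i)ᶜ := by
      simp [X, Finset.filter_eq_empty_iff]
    simp [indicator_apply, this]
  have hint : ∀ {B : Set Ω}, MeasurableSet B → Integrable (B.indicator (1 : Ω → ℝ)) P :=
    fun hB => (integrable_const (1 : ℝ)).indicator hB
  have hintS : ∀ k, Integrable (fun ω => ((X ω).choose k : ℝ)) P := by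
    intro k
    simp_rw [hchoose]
    exact integrable_finsetSum _ fun T hT => hint (hmeas k T hT)
  have hSk : ∀ k, ∫ ω, ((X ω).choose k : ℝ) ∂P
      = ∑ T ∈ s.powersetCard k, P.real (⋂ i ∈ T, E i) := by
    intro k
    simp_rw [hchoose]
    rw [integral_finsetSum _ fun T hT => hint (hmeas k T hT)]
    exact Finset.sum_congr rfl fun T hT => integral_indicator_one (hmeas k T hT)
  have h0 : ∫ ω, (if X ω = 0 then (1 : ℝ) else 0) ∂P = P.real (⋂ i ∈ s, (E i)ᶜ) := by
    simp_rw [hzero]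
    exact integral_indicator_one hmeas0
  have hint0 : Integrable (fun ω => if X ω = 0 then (1 : ℝ) else 0) P := by
    simp_rw [hzero]
    exact hint hmeas0
  have hsum : ∑ k ∈ Finset.range K, (-1 : ℝ) ^ k * ∑ T ∈ s.powersetCard k, P.real (⋂ i ∈ T, E i)
      = ∫ ω, ∑ k ∈ Finset.range K, (-1 : ℝ) ^ k * ((X ω).choose k : ℝ) ∂P := by
    rw [integral_finsetSum _ fun k _ => (hintS k).const_mul _]
    simp_rw [integral_const_mul, hSk]
  rw [hsum, ← h0, ← hSk,
    ← integral_sub hint0 (integrable_finsetSum _ fun k _ => (hintS k).const_mul _)]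
  refine (abs_integral_le_integral_abs).trans
    (integral_mono_of_nonneg (ae_of_all _ fun _ => abs_nonneg _) (hintS K)
      (ae_of_all _ fun ω => abs_ite_sub_sum_choose_le (X ω) K))

/-- If the binomial moments converge to those of a Poisson law, the probabilities of the value
zero converge, too. -/
lemma tendsto_exp_neg_of_binomial_moments {p : ℕ → ℝ} {S : ℕ → ℕ → ℝ} {l : ℝ}
    (hp : ∀ n K, |p n - ∑ k ∈ Finset.range K, (-1 : ℝ) ^ k * S n k| ≤ S n K)
    (hS : ∀ k, Tendsto (fun n => S n k) atTop (𝓝 (l ^ k / k.factorial))) :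
    Tendsto p atTop (𝓝 (Real.exp (-l))) := by
  have hexp : Tendsto (fun K => ∑ k ∈ Finset.range K, (-1 : ℝ) ^ k * (l ^ k / k.factorial)) atTop
      (𝓝 (Real.exp (-l))) := by
    have h := (NormedSpace.expSeries_div_hasSum_exp (-l)).tendsto_sum_nat
    rw [← Real.exp_eq_exp_ℝ] at h
    refine h.congr fun K => Finset.sum_congr rfl fun k _ => ?_
    rw [← mul_div_assoc, ← mul_pow, neg_one_mul]
  have hfac := FloorSemiring.tendsto_pow_div_factorial_atTop l
  rw [Metric.tendsto_atTop]
  intro ε hε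
  -- First fix `K` with both the series tail and the limiting error `l ^ K / K!` small; only then
  -- let `n` grow.
  obtain ⟨K, hK1, hK2⟩ := ((Metric.tendsto_nhds.1 hexp (ε / 4) (by positivity)).and
    (Metric.tendsto_nhds.1 hfac (ε / 4) (by positivity))).exists
  have h1 : Tendsto (fun n => ∑ k ∈ Finset.range K, (-1 : ℝ) ^ k * S n k) atTop
      (𝓝 (∑ k ∈ Finset.range K, (-1 : ℝ) ^ k * (l ^ k / k.factorial))) :=
    tendsto_finsetSum _ fun k _ => (hS k).const_mul _
  obtain ⟨N, hN⟩ := eventually_atTop.1 ((Metric.tendsto_nhds.1 h1 (ε / 4) (by positivity)).and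
    (Metric.tendsto_nhds.1 (hS K) (ε / 4) (by positivity)))
  refine ⟨N, fun n hn => ?_⟩
  obtain ⟨h3, h4⟩ := hN n hn
  have h5 := hp n K
  rw [Real.dist_eq] at *
  rw [abs_lt] at *
  rw [abs_le] at h5
  constructor <;> linarith [h5.1, h5.2, h3.1, h3.2, h4.1, h4.2, hK1.1, hK1.2, hK2.1, hK2.2]

/-- Pointwise convergence of distribution functions implies weak convergence. -/
lemma tendsto_probabilityMeasure_of_tendsto_Iic {μ : ℕ → ProbabilityMeasure ℝ}
    {ν : ProbabilityMeasure ℝ}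
    (h : ∀ z, Tendsto (fun n => (μ n : Measure ℝ).real (Iic z)) atTop
      (𝓝 ((ν : Measure ℝ).real (Iic z)))) :
    Tendsto μ atTop (𝓝 ν) := by
  have hIoc : ∀ (κ : ProbabilityMeasure ℝ) (a b : ℝ), a ≤ b →
      (κ : Measure ℝ).real (Ioc a b)
        = (κ : Measure ℝ).real (Iic b) - (κ : Measure ℝ).real (Iic a) := by
    intro κ a b hab
    rw [← Iic_sdiff_Iic, measureReal_sdiff (Iic_subset_Iic.2 hab) measurableSet_Iic]
  refine IsPiSystem.tendsto_probabilityMeasure_of_tendsto_of_mem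
    (isPiSystem_Ioc (id : ℝ → ℝ) id) ?_ ?_ ?_
  · rintro s ⟨a, b, -, rfl⟩
    exact measurableSet_Ioc
  · intro u hu x hx
    obtain ⟨δ, hδ, hsub⟩ := Metric.isOpen_iff.1 hu x hx
    refine ⟨Ioc (x - δ / 2) (x + δ / 2), ⟨x - δ / 2, x + δ / 2, by simp; linarith, rfl⟩,
      Ioc_mem_nhds (by linarith) (by linarith), fun y hy => hsub ?_⟩
    rw [Metric.mem_ball, Real.dist_eq, abs_lt]
    constructor <;> linarith [hy.1, hy.2]
  · rintro s ⟨a, b, hab, rfl⟩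
    have hab' : a ≤ b := le_of_lt hab
    have h2 := (h b).sub (h a)
    simp only [id] at *
    simp_rw [← hIoc _ _ _ hab'] at h2
    rw [← NNReal.tendsto_coe]
    exact h2

/-! ### Covering as a hitting event; volumes of balls -/

/-- The lines meeting the closed unit ball around `x`, i.e. the lines whose cylinder covers `x`. -/
def ballLines {d : ℕ} (x : Space d) : Set (Line d) := hitting (closedBall x 1)

lemma measurableSet_ballLines {d : ℕ} (x : Space d) : MeasurableSet (ballLines x) :=
  MeasurableSpace.measurableSet_generateFrom ⟨_, isCompact_closedBall x 1, rfl⟩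

/-- A line is closed and nonempty, so its distance to `x` is attained. This turns covering into
membership in a generator of the σ-algebra on lines. -/
lemma mem_cylinder_iff {d : ℕ} {L : Line d} {x : Space d} :
    x ∈ cylinder L ↔ L ∈ ballLines x := by
  have hne : L.carrier.Nonempty := by
    rw [Line.carrier, AffineSubspace.nonempty_iff_ne_bot]
    intro h
    have := L.2
    rw [h, AffineSubspace.direction_bot, finrank_bot] at this
    exact zero_ne_one this
  have hcl : IsClosed L.carrier := AffineSubspace.closed_of_finiteDimensional L.1
  constructor
  · intro h
    obtain ⟨y, hy, hxy⟩ := hcl.exists_infDist_eq_dist hne x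
    refine ⟨y, hy, ?_⟩
    rw [mem_closedBall, dist_comm, ← hxy]
    exact h
  · rintro ⟨y, hy, hxy⟩
    refine (infDist_le_dist_of_mem hy).trans ?_
    rw [dist_comm]
    exact hxy

/-- An orthonormal basis identifies `F` with a standard space. This compares balls in every
hyperplane `u^⊥` with the one constant used in the normalization. -/
lemma volume_closedBall_of_finrank_eq {F : Type*} [NormedAddCommGroup F] [InnerProductSpace ℝ F]
    [FiniteDimensional ℝ F] [MeasurableSpace F] [BorelSpace F] {k : ℕ}
    (hk : Module.finrank ℝ F = k) (x : F) {r : ℝ} (hr : 0 ≤ r) :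
    volume (closedBall x r) = ENNReal.ofReal (r ^ k) * volume (closedBall (0 : Space k) 1) := by
  let e : F ≃ₗᵢ[ℝ] Space k := ((stdOrthonormalBasis ℝ F).reindex (finCongr hk)).repr
  have h : e ⁻¹' closedBall (0 : Space k) 1 = closedBall (0 : F) 1 := by
    rw [e.preimage_closedBall, map_zero]
  rw [Measure.addHaar_closedBall' _ _ hr, hk, ← h,
    e.measurePreserving.measure_preimage measurableSet_closedBall.nullMeasurableSet]

/-! ### Projection along a direction -/

section perp

variable {d : ℕ}

/-- The component of `x` orthogonal to `u`. -/
def perp (u : UnitSphere d) (x : Space d) : Space d := x - ⟪(u : Space d), x⟫ • (u : Space d)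

lemma coe_orthogonalProjectionOnto_eq_perp (u : UnitSphere d) (x : Space d) :
    (((ℝ ∙ (u : Space d))ᗮ.orthogonalProjectionOnto x : _) : Space d) = perp u x := by
  have hx : (((ℝ ∙ (u : Space d)).orthogonalProjectionOnto x : _) : Space d)
      + (((ℝ ∙ (u : Space d))ᗮ.orthogonalProjectionOnto x : _) : Space d) = x := by
    simp
  have h2 : (((ℝ ∙ (u : Space d)).orthogonalProjectionOnto x : _) : Space d)
      = ⟪(u : Space d), x⟫ • (u : Space d) :=
    Submodule.starProjection_unit_singleton ℝ (norm_eq_of_mem_sphere u) x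
  rw [h2] at hx
  exact eq_sub_of_add_eq' hx

lemma perp_sub (u : UnitSphere d) (x y : Space d) : perp u (x - y) = perp u x - perp u y := by
  simp only [perp, inner_sub_right, sub_smul]
  abel

lemma perp_smul (u : UnitSphere d) (a : ℝ) (x : Space d) : perp u (a • x) = a • perp u x := by
  simp only [perp, inner_smul_right, smul_sub, mul_smul]

lemma norm_perp_le (u : UnitSphere d) (x : Space d) : ‖perp u x‖ ≤ ‖x‖ := by
  rw [← coe_orthogonalProjectionOnto_eq_perp]
  exact (ℝ ∙ (u : Space d))ᗮ.norm_orthogonalProjectionOnto_apply_le x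

lemma norm_sq_perp (u : UnitSphere d) (x : Space d) :
    ‖perp u x‖ ^ 2 = ‖x‖ ^ 2 - ⟪(u : Space d), x⟫ ^ 2 := by
  rw [perp, norm_sub_sq_real, norm_smul, norm_eq_of_mem_sphere, inner_smul_right,
    real_inner_comm, mul_one, Real.norm_eq_abs, sq_abs]
  ring

/-- Both sides are the sine of the angle between `u` and `v`. The symmetry turns a condition on a
varying projection into one on a fixed axis. -/
lemma norm_perp_comm (u v : UnitSphere d) : ‖perp u (v : Space d)‖ = ‖perp v (u : Space d)‖ := by
  rw [← sq_eq_sq₀ (norm_nonneg _) (norm_nonneg _), norm_sq_perp, norm_sq_perp,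
    norm_eq_of_mem_sphere, norm_eq_of_mem_sphere, real_inner_comm]

lemma perp_eq_self {u : UnitSphere d} {y : Space d} (hy : y ∈ (ℝ ∙ (u : Space d))ᗮ) :
    perp u y = y := by
  rw [perp, Submodule.mem_orthogonal_singleton_iff_inner_right.mp hy, zero_smul, sub_zero]

lemma continuous_perp (x : Space d) : Continuous fun u : UnitSphere d => perp u x := by
  unfold perp
  fun_prop

lemma finrank_orthogonal_unitSphere (u : UnitSphere d) :
    Module.finrank ℝ (ℝ ∙ (u : Space d))ᗮ = d - 1 := by
  have h := Submodule.finrank_add_finrank_orthogonal (ℝ ∙ (u : Space d))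
  rw [finrank_span_singleton (ne_zero_of_mem_unit_sphere u), finrank_euclideanSpace_fin] at h
  omega

/-- The foot points of the lines of direction `u` that meet the unit ball around `x`. -/
lemma lineThrough_mem_ballLines (u : UnitSphere d) (x : Space d) (y : (ℝ ∙ (u : Space d))ᗮ) :
    lineThrough u (y : Space d) ∈ ballLines x
      ↔ y ∈ closedBall ((ℝ ∙ (u : Space d))ᗮ.orthogonalProjectionOnto x) 1 := by
  rw [ballLines, lineThrough_mem_hitting, mem_closedBall, dist_eq_norm, Submodule.coe_norm,
    Submodule.coe_sub, coe_orthogonalProjectionOnto_eq_perp]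
  constructor
  · rintro ⟨z, hz, h⟩
    have h2 : perp u z = y := by
      rw [← sub_eq_zero, ← perp_eq_self y.2, ← perp_sub, perp, ← h, sub_self]
    rw [← h2, ← perp_sub]
    rw [mem_closedBall, dist_eq_norm] at hz
    exact (norm_perp_le _ _).trans hz
  · intro h
    have hu : ⟪(u : Space d), (u : Space d)⟫ = 1 := by
      rw [real_inner_self_eq_norm_sq, norm_eq_of_mem_sphere]; norm_num
    refine ⟨y + ⟪(u : Space d), x⟫ • (u : Space d), ?_, ?_⟩
    · rw [mem_closedBall, dist_eq_norm]
      convert h using 2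
      rw [perp]
      abel
    · rw [add_sub_cancel_left, inner_smul_right, hu, mul_one]

end perp

/-! ### Measure of sets of directions -/

lemma isProbabilityMeasure_directionMeasure {d : ℕ} (hd : 2 ≤ d) :
    IsProbabilityMeasure (directionMeasure d) := by
  have : Nontrivial (Space d) := by
    have : Nonempty (Fin d) := ⟨⟨0, by omega⟩⟩
    infer_instance
  refine ⟨?_⟩
  rw [directionMeasure, Measure.smul_apply, smul_eq_mul, ENNReal.inv_mul_cancel]
  · simp only [ne_eq, Measure.measure_univ_eq_zero, Measure.toSphere_ne_zero, not_false_eq_true]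
  · exact measure_ne_top _ _

open scoped Pointwise in
/-- The directions at small angle to a given vector have small measure. -/
lemma exists_directionMeasure_cap_le {d : ℕ} (hd : 2 ≤ d) :
    ∃ C : ℝ, 1 ≤ C ∧ ∀ x : Space d, x ≠ 0 → ∀ r : ℝ, 0 ≤ r →
      (directionMeasure d).real {u | ‖perp u x‖ ≤ r} ≤ C * (r / ‖x‖) := by
  have := isProbabilityMeasure_directionMeasure hd
  have hnt : Nontrivial (Space d) := by
    have : Nonempty (Fin d) := ⟨⟨0, by omega⟩⟩
    infer_instance
  set c : ℝ≥0∞ := ((volume : Measure (Space d)).toSphere univ)⁻¹ * (d *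
    (volume (closedBall (0 : Space 1) 1) * volume (closedBall (0 : Space (d - 1)) 1))) with hc
  have hctop : c ≠ ∞ := by
    refine ENNReal.mul_ne_top (ENNReal.inv_ne_top.2 ?_) (ENNReal.mul_ne_top
      (ENNReal.natCast_ne_top d) (ENNReal.mul_ne_top measure_closedBall_lt_top.ne
        measure_closedBall_lt_top.ne))
    simp only [ne_eq, Measure.measure_univ_eq_zero, Measure.toSphere_ne_zero, not_false_eq_true]
  have hslab : ∀ (v : UnitSphere d) (η : ℝ), 0 ≤ η →
      volume {w : Space d | |⟪(v : Space d), w⟫| ≤ 1 ∧ ‖perp v w‖ ≤ η}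
        = volume (closedBall (0 : Space 1) 1) *
          (ENNReal.ofReal (η ^ (d - 1)) * volume (closedBall (0 : Space (d - 1)) 1)) := by
    intro v η hη
    have hmp : MeasurePreserving
        (fun x : Space d => ((ℝ ∙ (v : Space d)).orthogonalProjectionOnto x,
          (ℝ ∙ (v : Space d))ᗮ.orthogonalProjectionOnto x)) volume volume := by
      have h := (WithLp.volume_preserving_ofLp (ℝ ∙ (v : Space d)) (ℝ ∙ (v : Space d))ᗮ).comp
        (ℝ ∙ (v : Space d)).orthogonalDecomposition.measurePreserving
      have he : (fun x : Space d => ((ℝ ∙ (v : Space d)).orthogonalProjectionOnto x,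
          (ℝ ∙ (v : Space d))ᗮ.orthogonalProjectionOnto x))
          = WithLp.ofLp ∘ (ℝ ∙ (v : Space d)).orthogonalDecomposition := by
        funext x
        simp
      rw [he]
      exact h
    have hpre : {w : Space d | |⟪(v : Space d), w⟫| ≤ 1 ∧ ‖perp v w‖ ≤ η}
        = (fun x : Space d => ((ℝ ∙ (v : Space d)).orthogonalProjectionOnto x,
          (ℝ ∙ (v : Space d))ᗮ.orthogonalProjectionOnto x)) ⁻¹'
          (closedBall 0 1 ×ˢ closedBall 0 η) := by
      ext w
      have h2 : (((ℝ ∙ (v : Space d)).orthogonalProjectionOnto w : _) : Space d)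
          = ⟪(v : Space d), w⟫ • (v : Space d) :=
        Submodule.starProjection_unit_singleton ℝ (norm_eq_of_mem_sphere v) w
      rw [mem_preimage, mem_prod, mem_closedBall_zero_iff, mem_closedBall_zero_iff,
        Submodule.coe_norm, Submodule.coe_norm, h2, coe_orthogonalProjectionOnto_eq_perp,
        norm_smul, norm_eq_of_mem_sphere, mul_one, Real.norm_eq_abs]
      rfl
    rw [hpre, hmp.measure_preimage
      (measurableSet_closedBall.prod measurableSet_closedBall).nullMeasurableSet,
      Measure.volume_eq_prod, Measure.prod_prod,
      volume_closedBall_of_finrank_eq (finrank_orthogonal_unitSphere v) _ hη,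
      volume_closedBall_of_finrank_eq
        (finrank_span_singleton (ne_zero_of_mem_unit_sphere v)) _ zero_le_one]
    simp
  have hcap : ∀ (v : UnitSphere d) (η : ℝ), 0 ≤ η →
      directionMeasure d {u | ‖perp u (v : Space d)‖ ≤ η} ≤ c * ENNReal.ofReal (η ^ (d - 1)) := by
    intro v η hη
    have hS : MeasurableSet {u : UnitSphere d | ‖perp u (v : Space d)‖ ≤ η} :=
      (isClosed_le (continuous_perp _).norm continuous_const).measurableSet
    -- The spherical measure of the cap is `d` times the volume of the cone over it, and this cone
    -- fits in the cylinder of half-length `1` and radius `η` around the axis `v`.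
    have hsub : Ioo (0 : ℝ) 1 • ((↑) '' {u : UnitSphere d | ‖perp u (v : Space d)‖ ≤ η})
        ⊆ {w : Space d | |⟪(v : Space d), w⟫| ≤ 1 ∧ ‖perp v w‖ ≤ η} := by
      rintro _ ⟨a, ha, _, ⟨u, hu, rfl⟩, rfl⟩
      have ha' : |a| ≤ 1 := by rw [abs_of_pos ha.1]; exact ha.2.le
      constructor
      · rw [inner_smul_right, abs_mul]
        refine mul_le_one₀ ha' (abs_nonneg _) ?_
        have := abs_real_inner_le_norm (v : Space d) (u : Space d)
        rwa [norm_eq_of_mem_sphere, norm_eq_of_mem_sphere, mul_one] at this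
      · rw [perp_smul, norm_smul, Real.norm_eq_abs, norm_perp_comm]
        exact (mul_le_of_le_one_left (norm_nonneg _) ha').trans hu
    rw [directionMeasure, Measure.smul_apply, smul_eq_mul, Measure.toSphere_apply' _ hS,
      finrank_euclideanSpace_fin]
    refine (mul_le_mul_right (mul_le_mul_right (measure_mono hsub) _) _).trans ?_
    rw [hslab v η hη, hc]
    apply le_of_eq
    ring
  refine ⟨max 1 c.toReal, le_max_left _ _, fun x hx r hr => ?_⟩
  have hx0 : 0 < ‖x‖ := norm_pos_iff.2 hx
  have hq : 0 ≤ r / ‖x‖ := by positivity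
  -- For a ratio of at least `1` the bound is trivial, as the constant is at least `1`. Below `1`,
  -- the power `d - 1 ≥ 1` may be weakened to the first power.
  rcases le_or_gt 1 (r / ‖x‖) with h1 | h1
  · calc _ ≤ (1 : ℝ) := measureReal_le_one
      _ ≤ max 1 c.toReal * (r / ‖x‖) := one_le_mul_of_one_le_of_one_le (le_max_left _ _) h1
  · let v : UnitSphere d := ⟨‖x‖⁻¹ • x, by
      rw [mem_sphere_zero_iff_norm, norm_smul, norm_inv, norm_norm, inv_mul_cancel₀ hx0.ne']⟩
    have hset : {u : UnitSphere d | ‖perp u x‖ ≤ r}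
        = {u : UnitSphere d | ‖perp u (v : Space d)‖ ≤ r / ‖x‖} := by
      ext u
      simp only [v, mem_ofPred_eq, perp_smul, norm_smul, norm_inv, norm_norm]
      rw [inv_mul_le_iff₀ hx0, mul_div_cancel₀ _ hx0.ne']
    rw [hset]
    have h := ENNReal.toReal_mono (ENNReal.mul_ne_top hctop ENNReal.ofReal_ne_top)
      (hcap v (r / ‖x‖) hq)
    rw [ENNReal.toReal_mul, ENNReal.toReal_ofReal (by positivity)] at h
    refine h.trans (mul_le_mul (le_max_right _ _) ?_ (by positivity) (by positivity))
    exact pow_le_of_le_one hq h1.le (by omega)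

/-! ### Overlaps and differences of the sets of lines meeting unit balls -/

section lineMeasure

variable {d : ℕ}

lemma lineMeasure_ballLines (hd : 2 ≤ d) (x : Space d) : lineMeasure d (ballLines x) = 1 := by
  have := isProbabilityMeasure_directionMeasure hd
  rw [lineMeasure_apply (measurableSet_ballLines x)]
  simp_rw [lineThrough_mem_ballLines, ofPred_mem_eq,
    volume_closedBall_of_finrank_eq (finrank_orthogonal_unitSphere _) _ zero_le_one]
  rw [lintegral_const, measure_univ, one_pow, ENNReal.ofReal_one, one_mul, mul_one]
  exact ENNReal.inv_mul_cancel (measure_closedBall_pos _ _ one_pos).ne'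
    measure_closedBall_lt_top.ne

/-- A line of direction `u` can meet both balls only if the projections of the centres to `u^⊥` are
within distance `2`. Such directions form a small double cap, and within each direction the mass is
at most one. -/
lemma exists_lineMeasure_inter_le (hd : 2 ≤ d) :
    ∃ C : ℝ, 0 < C ∧ ∀ x y : Space d, x ≠ y →
      (lineMeasure d).real (ballLines x ∩ ballLines y) ≤ C / dist x y := by
  have := isProbabilityMeasure_directionMeasure hd
  obtain ⟨C, hC1, hC⟩ := exists_directionMeasure_cap_le hd
  refine ⟨C * 2, by linarith, fun x y hxy => ?_⟩
  have hle : lineMeasure d (ballLines x ∩ ballLines y)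
      ≤ directionMeasure d {u | ‖perp u (x - y)‖ ≤ 2} := by
    rw [lineMeasure_apply ((measurableSet_ballLines x).inter (measurableSet_ballLines y))]
    have hbd : ∀ u : UnitSphere d, volume {z : (ℝ ∙ (u : Space d))ᗮ |
        lineThrough u (z : Space d) ∈ ballLines x ∩ ballLines y}
        ≤ {u : UnitSphere d | ‖perp u (x - y)‖ ≤ 2}.indicator
          (fun _ => volume (closedBall (0 : Space (d - 1)) 1)) u := by
      intro u
      by_cases hu : ‖perp u (x - y)‖ ≤ 2
      · rw [indicator_of_mem (by exact hu)]
        refine (measure_mono fun z hz => (lineThrough_mem_ballLines u x z).1 hz.1).trans ?_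
        rw [volume_closedBall_of_finrank_eq (finrank_orthogonal_unitSphere u) _ zero_le_one]
        simp
      · rw [indicator_of_notMem (by exact hu)]
        refine (measure_mono_null (t := ∅) (fun z hz => hu ?_) measure_empty).le
        have h1 := (lineThrough_mem_ballLines u x z).1 hz.1
        have h2 := (lineThrough_mem_ballLines u y z).1 hz.2
        have h3 := dist_triangle_left ((ℝ ∙ (u : Space d))ᗮ.orthogonalProjectionOnto x)
          ((ℝ ∙ (u : Space d))ᗮ.orthogonalProjectionOnto y) z
        rw [dist_eq_norm, Submodule.coe_norm, Submodule.coe_sub,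
          coe_orthogonalProjectionOnto_eq_perp, coe_orthogonalProjectionOnto_eq_perp,
          ← perp_sub] at h3
        rw [mem_closedBall] at h1 h2
        linarith
    refine (mul_le_mul_right (lintegral_mono hbd) _).trans ?_
    refine (mul_le_mul_right (lintegral_indicator_const_le _ _) _).trans ?_
    rw [← mul_assoc, ENNReal.inv_mul_cancel (measure_closedBall_pos _ _ one_pos).ne'
      measure_closedBall_lt_top.ne, one_mul]
  refine (ENNReal.toReal_mono (measure_ne_top _ _) hle).trans ?_
  refine (hC (x - y) (sub_ne_zero.2 hxy) 2 zero_le_two).trans_eq ?_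
  rw [dist_eq_norm, mul_div_assoc]

/-- Move from `a` straight away from `b` by `1 - s`: the small ball stays inside the ball around
`a`, and its centre is at distance `‖a - b‖ + 1 - s > 1 + s` from `b`. -/
lemma exists_closedBall_subset_diff {F : Type*} [NormedAddCommGroup F] [NormedSpace ℝ F]
    {a b : F} {s : ℝ} (hs : 0 < s) (hs1 : s ≤ 1) (hab : 2 * s < ‖a - b‖) :
    ∃ c, closedBall c s ⊆ closedBall a 1 \ closedBall b 1 := by
  have hδ : 0 < ‖a - b‖ := by linarith
  refine ⟨a + ((1 - s) / ‖a - b‖) • (a - b), fun z hz => ⟨?_, fun hzb => ?_⟩⟩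
  · have h1 : dist (a + ((1 - s) / ‖a - b‖) • (a - b)) a = 1 - s := by
      rw [dist_eq_norm, add_sub_cancel_left, norm_smul, norm_div, norm_norm, Real.norm_eq_abs,
        abs_of_nonneg (by linarith), div_mul_cancel₀ _ hδ.ne']
    rw [mem_closedBall] at *
    linarith [dist_triangle z (a + ((1 - s) / ‖a - b‖) • (a - b)) a]
  · have h1 : dist (a + ((1 - s) / ‖a - b‖) • (a - b)) b = ‖a - b‖ + (1 - s) := by
      have : a + ((1 - s) / ‖a - b‖) • (a - b) - b = (1 + (1 - s) / ‖a - b‖) • (a - b) := by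
        rw [add_smul, one_smul]
        abel
      have h0 : 0 ≤ (1 - s) / ‖a - b‖ := div_nonneg (by linarith) hδ.le
      rw [dist_eq_norm, this, norm_smul, Real.norm_eq_abs, abs_of_nonneg (by linarith), add_mul,
        one_mul, div_mul_cancel₀ _ hδ.ne']
    rw [mem_closedBall] at *
    linarith [dist_triangle_left (a + ((1 - s) / ‖a - b‖) • (a - b)) b z]

/-- For at least half of the directions the projected centres stay more than `δ` apart, and then the
difference of the projected unit balls contains a ball of fixed radius `s`. -/
lemma exists_le_lineMeasure_diff (hd : 2 ≤ d) {ρ : ℝ} (hρ : 0 < ρ) :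
    ∃ ε : ℝ, 0 < ε ∧ ∀ x y : Space d, ρ ≤ dist x y →
      ε ≤ (lineMeasure d).real (ballLines x \ ballLines y) := by
  have := isProbabilityMeasure_directionMeasure hd
  obtain ⟨C, hC1, hC⟩ := exists_directionMeasure_cap_le hd
  have hCpos : 0 < C := by linarith
  -- Chosen so that the cap estimate gives the bad directions probability at most `1 / 2`.
  set δ : ℝ := ρ / (2 * C) with hδ
  have hδ0 : 0 < δ := by positivity
  set s : ℝ := min (δ / 2) 1 with hs
  have hs0 : 0 < s := lt_min (by linarith) one_pos
  refine ⟨s ^ (d - 1) * (1 / 2), by positivity, fun x y hxy => ?_⟩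
  have hxy0 : 0 < ‖x - y‖ := by rw [← dist_eq_norm]; linarith
  have hS : MeasurableSet {u : UnitSphere d | ‖perp u (x - y)‖ ≤ δ} :=
    (isClosed_le (continuous_perp _).norm continuous_const).measurableSet
  have hhalf : 1 / 2 ≤ (directionMeasure d).real {u : UnitSphere d | ‖perp u (x - y)‖ ≤ δ}ᶜ := by
    rw [probReal_compl_eq_one_sub hS]
    have h1 := hC (x - y) (norm_pos_iff.1 hxy0) δ hδ0.le
    have h2 : C * (δ / ‖x - y‖) ≤ 1 / 2 := by
      rw [← mul_div_assoc, div_le_iff₀ hxy0]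
      have : C * δ = ρ / 2 := by rw [hδ]; field_simp
      rw [this]
      rw [dist_eq_norm] at hxy
      linarith
    linarith
  have hle : ENNReal.ofReal (s ^ (d - 1)) *
      directionMeasure d {u : UnitSphere d | ‖perp u (x - y)‖ ≤ δ}ᶜ
      ≤ lineMeasure d (ballLines x \ ballLines y) := by
    rw [lineMeasure_apply ((measurableSet_ballLines x).diff (measurableSet_ballLines y))]
    have hbd : ∀ u : UnitSphere d, {u : UnitSphere d | ‖perp u (x - y)‖ ≤ δ}ᶜ.indicator
        (fun _ => ENNReal.ofReal (s ^ (d - 1)) * volume (closedBall (0 : Space (d - 1)) 1)) u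
        ≤ volume {z : (ℝ ∙ (u : Space d))ᗮ |
          lineThrough u (z : Space d) ∈ ballLines x \ ballLines y} := by
      intro u
      by_cases hu : ‖perp u (x - y)‖ ≤ δ
      · rw [indicator_of_notMem (by exact fun h => h hu)]
        exact zero_le
      · rw [indicator_of_mem (by exact hu)]
        have hlt : 2 * s < ‖(ℝ ∙ (u : Space d))ᗮ.orthogonalProjectionOnto x
            - (ℝ ∙ (u : Space d))ᗮ.orthogonalProjectionOnto y‖ := by
          rw [Submodule.coe_norm, Submodule.coe_sub, coe_orthogonalProjectionOnto_eq_perp,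
            coe_orthogonalProjectionOnto_eq_perp, ← perp_sub]
          have : s ≤ δ / 2 := min_le_left _ _
          linarith [not_le.1 hu]
        obtain ⟨c, hc⟩ := exists_closedBall_subset_diff hs0 (min_le_right _ _) hlt
        rw [← volume_closedBall_of_finrank_eq (finrank_orthogonal_unitSphere u) c hs0.le]
        exact measure_mono fun z hz => ⟨(lineThrough_mem_ballLines u x z).2 (hc hz).1,
          fun h => (hc hz).2 ((lineThrough_mem_ballLines u y z).1 h)⟩
    refine le_trans (le_of_eq ?_) (mul_le_mul_right (lintegral_mono hbd) _)
    rw [lintegral_indicator_const hS.compl, mul_comm (ENNReal.ofReal _) (volume _), ← mul_assoc,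
      ← mul_assoc, ENNReal.inv_mul_cancel (measure_closedBall_pos _ _ one_pos).ne'
      measure_closedBall_lt_top.ne, one_mul]
  have htop : lineMeasure d (ballLines x \ ballLines y) ≠ ∞ :=
    ((measure_mono sdiff_subset).trans_lt
      ((lineMeasure_ballLines hd x).trans_lt ENNReal.one_lt_top)).ne
  have h := ENNReal.toReal_mono htop hle
  rw [ENNReal.toReal_mul, ENNReal.toReal_ofReal (by positivity)] at h
  exact (mul_le_mul_of_nonneg_left hhalf (by positivity)).trans h

end lineMeasure

/-! ### Exponential sums over `k`-subsets for an abstract family of sets of measure one -/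

section unitCover

variable {α β : Type*} [MeasurableSpace β] {m : Measure β} {B : α → Set β}

lemma measure_biUnion_le_card (h1 : ∀ x, m (B x) = 1) (T : Finset α) :
    m (⋃ x ∈ T, B x) ≤ T.card := by
  refine (measure_biUnion_finset_le T B).trans ?_
  simp [h1]

lemma measureReal_biUnion_le_card (h1 : ∀ x, m (B x) = 1) (T : Finset α) :
    m.real (⋃ x ∈ T, B x) ≤ T.card :=
  ENNReal.toReal_mono (ENNReal.natCast_ne_top _) (measure_biUnion_le_card h1 T)

lemma measure_biUnion_ne_top (h1 : ∀ x, m (B x) = 1) (T : Finset α) :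
    m (⋃ x ∈ T, B x) ≠ ∞ :=
  ((measure_biUnion_le_card h1 T).trans_lt (ENNReal.natCast_lt_top _)).ne

/-- If `D ⊆ B y`, adding `y` to `U` increases the measure of the union by at least the measure
of `D`, up to the overlaps of `D` with the sets already present. -/
lemma le_measureReal_biUnion_insert [DecidableEq α] (hB : ∀ x, MeasurableSet (B x))
    (h1 : ∀ x, m (B x) = 1) (U : Finset α) (y : α) {D : Set β} (hD : MeasurableSet D)
    (hDB : D ⊆ B y) :
    m.real (⋃ x ∈ U, B x) + m.real D - ∑ x ∈ U, m.real (D ∩ B x)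
      ≤ m.real (⋃ x ∈ insert y U, B x) := by
  have hU : MeasurableSet (⋃ x ∈ U, B x) := Finset.measurableSet_biUnion _ fun x _ => hB x
  have hyt : m (B y) ≠ ∞ := by rw [h1]; exact ENNReal.one_ne_top
  have hDt : m D ≠ ∞ := ((measure_mono hDB).trans_lt hyt.lt_top).ne
  have hle : m.real ((⋃ x ∈ U, B x) ∪ D) ≤ m.real (⋃ x ∈ insert y U, B x) := by
    refine measureReal_mono ?_ (measure_biUnion_ne_top h1 _)
    rw [Finset.set_biUnion_insert, union_comm]
    exact union_subset_union_left _ hDB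
  have hinter : m.real ((⋃ x ∈ U, B x) ∩ D) ≤ ∑ x ∈ U, m.real (D ∩ B x) := by
    have : (⋃ x ∈ U, B x) ∩ D = ⋃ x ∈ U, (D ∩ B x) := by
      rw [inter_comm, inter_iUnion₂]
    rw [this]
    exact measureReal_biUnion_finset_le _ _
  have := measureReal_union_add_inter (μ := m) (s := ⋃ x ∈ U, B x) (t := D) hD
    (measure_biUnion_ne_top h1 U) hDt
  linarith

variable [MetricSpace α]

/-- Points are added one at a time; each contributes measure one, minus at most `C / D` for every
point already present. -/
lemma le_measureReal_biUnion_of_separated (hB : ∀ x, MeasurableSet (B x))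
    (h1 : ∀ x, m (B x) = 1) {C : ℝ} (hC0 : 0 < C)
    (hC : ∀ x y, x ≠ y → m.real (B x ∩ B y) ≤ C / dist x y) {D : ℝ} (hD : 0 < D) (U : Finset α)
    (hU : ∀ x ∈ U, ∀ y ∈ U, x ≠ y → D ≤ dist x y) :
    (U.card : ℝ) - (U.card : ℝ) ^ 2 * (C / D) ≤ m.real (⋃ x ∈ U, B x) := by
  classical
  induction U using Finset.induction_on with
  | empty => simp
  | insert y U hy ih =>
    have ih' := ih fun a ha b hb =>
      hU a (Finset.mem_insert_of_mem ha) b (Finset.mem_insert_of_mem hb)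
    have h2 := le_measureReal_biUnion_insert hB h1 U y (hB y) subset_rfl
    have hsum : ∑ x ∈ U, m.real (B y ∩ B x) ≤ U.card * (C / D) := by
      rw [← nsmul_eq_mul]
      refine Finset.sum_le_card_nsmul _ _ _ fun x hx => ?_
      have hyx : y ≠ x := fun h => hy (h ▸ hx)
      refine (hC y x hyx).trans (div_le_div_of_nonneg_left hC0.le hD ?_)
      exact hU y (Finset.mem_insert_self _ _) x (Finset.mem_insert_of_mem hx) hyx
    have hy1 : m.real (B y) = 1 := by rw [measureReal_def, h1, ENNReal.toReal_one]
    rw [hy1] at h2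
    rw [Finset.card_insert_of_notMem hy]
    push_cast
    have hCD : 0 < C / D := by positivity
    nlinarith [mul_nonneg (Nat.cast_nonneg (α := ℝ) U.card) hCD.le]

/-- A set of points that is not separated contains a smaller set of points with the same
neighbourhood, and the union over the larger set has significantly more measure. -/
lemma exists_subset_le_measureReal_biUnion (hB : ∀ x, MeasurableSet (B x))
    (h1 : ∀ x, m (B x) = 1) {C : ℝ} (hC0 : 0 < C)
    (hC : ∀ x y, x ≠ y → m.real (B x ∩ B y) ≤ C / dist x y) {ρ ε : ℝ}
    (hε : ∀ x y, ρ ≤ dist x y → ε ≤ m.real (B x \ B y)) {D : ℝ} (hD : 0 < D) (T : Finset α)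
    (hT : ∀ x ∈ T, ∀ y ∈ T, x ≠ y → ρ ≤ dist x y)
    (hTD : ¬ ∀ x ∈ T, ∀ y ∈ T, x ≠ y → D ≤ dist x y) :
    ∃ U ⊆ T, U.card < T.card ∧ (∀ x ∈ T, ∃ u ∈ U, dist u x ≤ D) ∧
      (U.card : ℝ) + ε - 3 * (T.card : ℝ) ^ 2 * (C / D) ≤ m.real (⋃ x ∈ T, B x) := by
  classical
  -- A `D`-separated subset of maximal cardinality is automatically a `D`-net of `T`.
  obtain ⟨U, hUmem, hUmax⟩ := Finset.exists_max_image
    (T.powerset.filter fun U => ∀ x ∈ U, ∀ y ∈ U, x ≠ y → D ≤ dist x y) Finset.card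
    ⟨∅, by simp⟩
  rw [Finset.mem_filter, Finset.mem_powerset] at hUmem
  obtain ⟨hUT, hUsep⟩ := hUmem
  have hnear : ∀ y ∈ T, y ∉ U → ∃ u ∈ U, dist u y < D := by
    intro y hy hyU
    by_contra! hcon
    have := hUmax (insert y U) (by
      rw [Finset.mem_filter, Finset.mem_powerset]
      refine ⟨Finset.insert_subset hy hUT, fun a ha b hb hab => ?_⟩
      rcases Finset.mem_insert.1 ha with ha' | ha' <;> rcases Finset.mem_insert.1 hb with hb' | hb'
      · exact absurd (ha'.trans hb'.symm) hab
      · rw [ha', dist_comm]; exact hcon b hb'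
      · rw [hb']; exact hcon a ha'
      · exact hUsep a ha' b hb' hab)
    rw [Finset.card_insert_of_notMem hyU] at this
    omega
  have hne : U ≠ T := fun h => hTD (h ▸ hUsep)
  have hss : U ⊂ T := hUT.ssubset_of_ne hne
  have hcard := Finset.card_lt_card hss
  refine ⟨U, hUT, hcard, fun x hx => ?_, ?_⟩
  · by_cases hxU : x ∈ U
    · exact ⟨x, hxU, by rw [dist_self]; exact hD.le⟩
    · obtain ⟨u, hu, h⟩ := hnear x hx hxU
      exact ⟨u, hu, h.le⟩
  obtain ⟨y, hyT, hyU⟩ := Finset.exists_of_ssubset hss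
  obtain ⟨u₁, hu₁, -⟩ := hnear y hyT hyU
  -- Since `y` may be close to its nearest point `u`, only `B y \ B u` is counted as new. Every
  -- other point of `U` is `D`-far from `u`, hence at distance at least `D / 2` from `y`.
  obtain ⟨u, hu, hmin⟩ := Finset.exists_min_image U (fun u => dist u y) ⟨u₁, hu₁⟩
  have hyu : y ≠ u := fun h => hyU (h ▸ hu)
  have hDpos : 0 < C / D := by positivity
  have h2 := le_measureReal_biUnion_insert hB h1 U y ((hB y).diff (hB u)) sdiff_subset
  have h3 := le_measureReal_biUnion_of_separated hB h1 hC0 hC hD U hUsep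
  have h4 : m.real (⋃ x ∈ insert y U, B x) ≤ m.real (⋃ x ∈ T, B x) := by
    refine measureReal_mono ?_ (measure_biUnion_ne_top h1 _)
    exact biUnion_subset_biUnion_left (Finset.insert_subset hyT hUT)
  have h5 : ∑ x ∈ U, m.real ((B y \ B u) ∩ B x) ≤ U.card * (2 * (C / D)) := by
    rw [← nsmul_eq_mul]
    refine Finset.sum_le_card_nsmul _ _ _ fun x hx => ?_
    rcases eq_or_ne x u with rfl | hxu
    · rw [sdiff_inter_self, measureReal_empty]
      positivity
    · have hyx : y ≠ x := fun h => hyU (h ▸ hx)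
      have hdist : D / 2 ≤ dist y x := by
        have a1 := hUsep u hu x hx hxu.symm
        have a2 := hmin x hx
        have a3 := dist_triangle u y x
        rw [dist_comm x y] at a2
        linarith
      have hyt : m (B y) ≠ ∞ := by rw [h1]; exact ENNReal.one_ne_top
      calc m.real ((B y \ B u) ∩ B x) ≤ m.real (B y ∩ B x) :=
            measureReal_mono (inter_subset_inter_left _ sdiff_subset)
              ((measure_mono inter_subset_left).trans_lt hyt.lt_top).ne
        _ ≤ C / dist y x := hC y x hyx
        _ ≤ C / (D / 2) := div_le_div_of_nonneg_left hC0.le (by positivity) hdist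
        _ = 2 * (C / D) := by field_simp
  have h6 := hε y u (hT y hyT u (hUT hu) hyu)
  have h7 : (U.card : ℝ) ≤ T.card := by exact_mod_cast hcard.le
  have h8 : (1 : ℝ) ≤ T.card := by exact_mod_cast Finset.card_pos.2 ⟨y, hyT⟩
  have h9 : (U.card : ℝ) ^ 2 * (C / D) ≤ (T.card : ℝ) ^ 2 * (C / D) := by gcongr
  have h10 : (U.card : ℝ) * (2 * (C / D)) ≤ (T.card : ℝ) ^ 2 * (2 * (C / D)) := by
    gcongr
    nlinarith
  linarith

/-- The sum over all `k`-subsets of `s` that are not `D`-separated. -/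
lemma sum_not_separated_le (hB : ∀ x, MeasurableSet (B x))
    (h1 : ∀ x, m (B x) = 1) {C : ℝ} (hC0 : 0 < C)
    (hC : ∀ x y, x ≠ y → m.real (B x ∩ B y) ≤ C / dist x y) {ρ ε : ℝ}
    (hε : ∀ x y, ρ ≤ dist x y → ε ≤ m.real (B x \ B y)) {D : ℝ} (hD : 0 < D) (s : Finset α)
    (hs : ∀ x ∈ s, ∀ y ∈ s, x ≠ y → ρ ≤ dist x y) {N : ℝ}
    (hN : ∀ x ∈ s, ((s.filter fun y => dist x y ≤ D).card : ℝ) ≤ N) (hs0 : s.Nonempty)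
    {z t : ℝ} (ht : t = Real.log s.card + z) (ht0 : 0 ≤ t) (k : ℕ)
    [DecidablePred fun T : Finset α => ∀ x ∈ T, ∀ y ∈ T, x ≠ y → D ≤ dist x y] :
    ∑ T ∈ (s.powersetCard k).filter (fun T => ¬ ∀ x ∈ T, ∀ y ∈ T, x ≠ y → D ≤ dist x y),
        Real.exp (-(t * m.real (⋃ x ∈ T, B x)))
      ≤ (k * N) ^ k * Real.exp (-(t * ε)) * Real.exp (3 * (k : ℝ) ^ 2 * C * (t / D)) *
        ∑ c ∈ Finset.range k, Real.exp (-z) ^ c := by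
  classical
  have hN0 : 0 ≤ N := (Nat.cast_nonneg _).trans (hN _ hs0.choose_spec)
  set g : ℕ → ℝ := fun c => Real.exp (-(t * (c + ε - 3 * (k : ℝ) ^ 2 * (C / D)))) with hg
  let nb : Finset α → Finset α := fun U => s.filter fun y => ∃ u ∈ U, dist u y ≤ D
  have hg0 : ∀ c, 0 ≤ g c := fun c => (Real.exp_pos _).le
  -- Each `T` is charged to one net `U` of size `c < k`. Summing over all candidate `U` overcounts,
  -- harmlessly, since the terms are nonnegative.
  have hpt : ∀ T ∈ (s.powersetCard k).filter (fun T => ¬ ∀ x ∈ T, ∀ y ∈ T, x ≠ y → D ≤ dist x y),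
      Real.exp (-(t * m.real (⋃ x ∈ T, B x))) ≤ ∑ c ∈ Finset.range k, ∑ U ∈ s.powersetCard c,
        if T ∈ (nb U).powersetCard k then g c else 0 := by
    intro T hT
    rw [Finset.mem_filter, Finset.mem_powersetCard] at hT
    obtain ⟨⟨hTs, hTk⟩, hTD⟩ := hT
    obtain ⟨U, hUT, hcard, hnear, hle⟩ := exists_subset_le_measureReal_biUnion hB h1 hC0 hC hε hD T
      (fun x hx y hy => hs x (hTs hx) y (hTs hy)) hTD
    rw [hTk] at hcard hle
    have hTnb : T ∈ (nb U).powersetCard k := by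
      rw [Finset.mem_powersetCard]
      exact ⟨fun x hx => Finset.mem_filter.2 ⟨hTs hx, hnear x hx⟩, hTk⟩
    have hterm : ∀ c U, (0 : ℝ) ≤ if T ∈ (nb U).powersetCard k then g c else 0 := by
      intro c U
      split_ifs
      exacts [hg0 c, le_rfl]
    calc Real.exp (-(t * m.real (⋃ x ∈ T, B x))) ≤ g U.card :=
          Real.exp_le_exp.2 (neg_le_neg (mul_le_mul_of_nonneg_left hle ht0))
      _ = if T ∈ (nb U).powersetCard k then g U.card else 0 := by rw [if_pos hTnb]
      _ ≤ ∑ V ∈ s.powersetCard U.card, if T ∈ (nb V).powersetCard k then g U.card else 0 :=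
          Finset.single_le_sum
            (f := fun V => if T ∈ (nb V).powersetCard k then g U.card else 0)
            (fun V _ => hterm _ V) (Finset.mem_powersetCard.2 ⟨hUT.trans hTs, rfl⟩)
      _ ≤ _ := Finset.single_le_sum
            (f := fun c => ∑ V ∈ s.powersetCard c, if T ∈ (nb V).powersetCard k then g c else 0)
            (fun c _ => Finset.sum_nonneg fun V _ => hterm c V) (Finset.mem_range.2 hcard)
  have hcount : ∀ c < k, ∀ U ∈ s.powersetCard c,
      (((nb U).powersetCard k).card : ℝ) ≤ (k * N) ^ k := by
    intro c hc U hU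
    rw [Finset.mem_powersetCard] at hU
    have hnbU : ((nb U).card : ℝ) ≤ k * N := by
      have hsub : nb U ⊆ U.biUnion fun u => s.filter fun y => dist u y ≤ D := by
        intro y hy
        obtain ⟨hys, u, hu, huy⟩ := Finset.mem_filter.1 hy
        exact Finset.mem_biUnion.2 ⟨u, hu, Finset.mem_filter.2 ⟨hys, huy⟩⟩
      calc ((nb U).card : ℝ) ≤ ∑ u ∈ U, ((s.filter fun y => dist u y ≤ D).card : ℝ) := by
            exact_mod_cast (Finset.card_le_card hsub).trans Finset.card_biUnion_le
        _ ≤ U.card • N := Finset.sum_le_card_nsmul _ _ _ fun u hu => hN u (hU.1 hu)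
        _ ≤ k * N := by
            rw [nsmul_eq_mul, hU.2]
            gcongr
    rw [Finset.card_powersetCard]
    calc (((nb U).card.choose k : ℕ) : ℝ) ≤ ((nb U).card : ℝ) ^ k := by
          exact_mod_cast Nat.choose_le_pow _ _
      _ ≤ (k * N) ^ k := by gcongr
  have hcardpos : (0 : ℝ) < s.card := by exact_mod_cast hs0.card_pos
  -- The number of choices of `U` is at most `s.card ^ c`, and `log s.card = t - z` cancels it
  -- against `exp (-t c)`, leaving `exp (-z) ^ c`.
  have hU : ∀ c < k, ((s.powersetCard c).card : ℝ) * g c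
      ≤ Real.exp (-(t * ε)) * Real.exp (3 * (k : ℝ) ^ 2 * C * (t / D)) * Real.exp (-z) ^ c := by
    intro c hc
    rw [Finset.card_powersetCard]
    calc ((s.card.choose c : ℕ) : ℝ) * g c ≤ (s.card : ℝ) ^ c * g c := by
          refine mul_le_mul_of_nonneg_right ?_ (hg0 c)
          exact_mod_cast Nat.choose_le_pow _ _
      _ = _ := by
          rw [hg, ← Real.exp_nat_mul, ← Real.exp_log hcardpos, ← Real.exp_nat_mul,
            ← Real.exp_add, ← Real.exp_add, ← Real.exp_add]
          congr 1
          have : Real.log s.card = t - z := by rw [ht]; ring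
          rw [this]
          ring
  calc _ ≤ ∑ T ∈ (s.powersetCard k).filter
          (fun T => ¬ ∀ x ∈ T, ∀ y ∈ T, x ≠ y → D ≤ dist x y),
          ∑ c ∈ Finset.range k, ∑ U ∈ s.powersetCard c,
            (if T ∈ (nb U).powersetCard k then g c else 0) := Finset.sum_le_sum hpt
    _ = ∑ c ∈ Finset.range k, ∑ U ∈ s.powersetCard c, ∑ T ∈ (s.powersetCard k).filter
          (fun T => ¬ ∀ x ∈ T, ∀ y ∈ T, x ≠ y → D ≤ dist x y),
            (if T ∈ (nb U).powersetCard k then g c else 0) := by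
        rw [Finset.sum_comm]
        exact Finset.sum_congr rfl fun c _ => Finset.sum_comm
    _ ≤ ∑ c ∈ Finset.range k, ∑ U ∈ s.powersetCard c, (k * N) ^ k * g c := by
        refine Finset.sum_le_sum fun c hc => Finset.sum_le_sum fun U hU => ?_
        rw [← Finset.sum_filter, Finset.sum_const, nsmul_eq_mul]
        refine mul_le_mul_of_nonneg_right ?_ (hg0 c)
        refine le_trans ?_ (hcount c (Finset.mem_range.1 hc) U hU)
        exact_mod_cast Finset.card_le_card fun T hT => (Finset.mem_filter.1 hT).2
    _ ≤ ∑ c ∈ Finset.range k, (k * N) ^ k * (Real.exp (-(t * ε)) *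
          Real.exp (3 * (k : ℝ) ^ 2 * C * (t / D)) * Real.exp (-z) ^ c) := by
        refine Finset.sum_le_sum fun c hc => ?_
        rw [Finset.sum_const, nsmul_eq_mul, mul_left_comm]
        exact mul_le_mul_of_nonneg_left (hU c (Finset.mem_range.1 hc)) (by positivity)
    _ = _ := by
        rw [Finset.mul_sum]
        exact Finset.sum_congr rfl fun c _ => by ring

lemma sum_separated_le (hB : ∀ x, MeasurableSet (B x))
    (h1 : ∀ x, m (B x) = 1) {C : ℝ} (hC0 : 0 < C)
    (hC : ∀ x y, x ≠ y → m.real (B x ∩ B y) ≤ C / dist x y) {D : ℝ} (hD : 0 < D) (s : Finset α)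
    {t : ℝ} (ht0 : 0 ≤ t) (k : ℕ)
    [DecidablePred fun T : Finset α => ∀ x ∈ T, ∀ y ∈ T, x ≠ y → D ≤ dist x y] :
    ∑ T ∈ (s.powersetCard k).filter (fun T => ∀ x ∈ T, ∀ y ∈ T, x ≠ y → D ≤ dist x y),
        Real.exp (-(t * m.real (⋃ x ∈ T, B x)))
      ≤ s.card.choose k * Real.exp (-(t * k)) * Real.exp ((k : ℝ) ^ 2 * C * (t / D)) := by
  calc _ ≤ ((s.powersetCard k).filter
        (fun T => ∀ x ∈ T, ∀ y ∈ T, x ≠ y → D ≤ dist x y)).card •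
          (Real.exp (-(t * k)) * Real.exp ((k : ℝ) ^ 2 * C * (t / D))) := by
        refine Finset.sum_le_card_nsmul _ _ _ fun T hT => ?_
        rw [Finset.mem_filter, Finset.mem_powersetCard] at hT
        have h := le_measureReal_biUnion_of_separated hB h1 hC0 hC hD T hT.2
        rw [hT.1.2] at h
        rw [← Real.exp_add]
        refine Real.exp_le_exp.2 ?_
        have h2 := mul_le_mul_of_nonneg_left h ht0
        have h3 : t * ((k : ℝ) - (k : ℝ) ^ 2 * (C / D))
          = t * k - (k : ℝ) ^ 2 * C * (t / D) := by ring
        linarith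
    _ ≤ _ := by
        rw [nsmul_eq_mul, ← mul_assoc]
        gcongr
        rw [← Finset.card_powersetCard]
        exact_mod_cast Finset.card_filter_le _ _

/-- Convergence of the binomial moments of the number of points which are not covered. -/
lemma tendsto_sum_exp_neg_measureReal (hB : ∀ x, MeasurableSet (B x))
    (h1 : ∀ x, m (B x) = 1) {C : ℝ} (hC0 : 0 < C)
    (hC : ∀ x y, x ≠ y → m.real (B x ∩ B y) ≤ C / dist x y) {ρ ε : ℝ} (hε0 : 0 < ε)
    (hε : ∀ x y, ρ ≤ dist x y → ε ≤ m.real (B x \ B y)) (s : ℕ → Finset α)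
    (hs : ∀ n, ∀ x ∈ s n, ∀ y ∈ s n, x ≠ y → ρ ≤ dist x y) {A : ℝ} {p : ℕ}
    (hA : ∀ n, ∀ x ∈ s n, ∀ D, 1 ≤ D →
      (((s n).filter fun y => dist x y ≤ D).card : ℝ) ≤ A * D ^ p)
    (hcard : Tendsto (fun n => (s n).card) atTop atTop) (z : ℝ) (k : ℕ) :
    Tendsto (fun n => ∑ T ∈ (s n).powersetCard k,
        Real.exp (-((Real.log (s n).card + z) * m.real (⋃ x ∈ T, B x)))) atTop
      (𝓝 (Real.exp (-z) ^ k / k.factorial)) := by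
  classical
  set l : ℕ → ℝ := fun n => Real.log (s n).card with hl
  have hlt : Tendsto l atTop atTop :=
    Real.tendsto_log_atTop.comp (tendsto_natCast_atTop_atTop.comp hcard)
  have hmain : Tendsto (fun n => ((s n).card.choose k : ℝ) * Real.exp (-((l n + z) * k))) atTop
      (𝓝 (Real.exp (-z) ^ k / k.factorial)) := by
    -- Here `exp (-t)` equals `exp (-z)` divided by the number of points, so this is the
    -- binomial-to-Poisson limit.
    have h := (tendsto_choose_mul_pow_atTop (p := fun n : ℕ => Real.exp (-z) / n)
      (r := Real.exp (-z)) k (by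
        refine tendsto_const_nhds.congr' ?_
        filter_upwards [eventually_ge_atTop 1] with n hn
        have : (n : ℝ) ≠ 0 := by positivity
        field_simp)).comp hcard
    refine h.congr' ?_
    filter_upwards [hcard.eventually_ge_atTop 1] with n hn
    have hpos : (0 : ℝ) < (s n).card := by exact_mod_cast hn
    simp only [Function.comp, hl]
    congr 1
    rw [← Real.exp_log hpos, Real.log_exp, ← Real.exp_sub, ← Real.exp_nat_mul]
    congr 1
    ring
  -- The scale `D = l n ^ 2` is large enough for `t / D → 0`, and small enough that `D ^ p` remains
  -- a power of the logarithm.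
  have hratio : Tendsto (fun n => (l n + z) / l n ^ 2) atTop (𝓝 0) := by
    have h := (tendsto_inv_atTop_zero.comp hlt).add
      (((tendsto_inv_atTop_zero.comp hlt).pow 2).const_mul z)
    simp only [Function.comp] at h
    rw [zero_pow two_ne_zero, mul_zero, add_zero] at h
    refine h.congr' ?_
    filter_upwards [hlt.eventually_gt_atTop 0] with n hn
    field_simp
  have hexp : ∀ c : ℝ, Tendsto (fun n => Real.exp (c * ((l n + z) / l n ^ 2))) atTop (𝓝 1) := by
    intro c
    have h := (Real.continuous_exp.tendsto _).comp (hratio.const_mul c)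
    rwa [mul_zero, Real.exp_zero] at h
  -- A power of the logarithm loses against `exp (-(t * ε))`, a negative power of the number of
  -- points.
  have hpoly : Tendsto (fun n => ((k : ℝ) * (A * (l n ^ 2) ^ p)) ^ k *
      Real.exp (-((l n + z) * ε))) atTop (𝓝 0) := by
    have h := ((Real.tendsto_pow_mul_exp_neg_atTop_nhds_zero (2 * p * k)).comp
      (hlt.const_mul_atTop hε0)).const_mul
      ((k * A) ^ k * Real.exp (-(z * ε)) * (ε⁻¹) ^ (2 * p * k))
    rw [mul_zero] at h
    refine h.congr fun n => ?_
    simp only [Function.comp]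
    have e1 : Real.exp (-((l n + z) * ε)) = Real.exp (-(ε * l n)) * Real.exp (-(z * ε)) := by
      rw [← Real.exp_add]
      congr 1
      ring
    have e2 : ε⁻¹ ^ (2 * p * k) * (ε * l n) ^ (2 * p * k) = ((l n ^ 2) ^ p) ^ k := by
      rw [← mul_pow, inv_mul_cancel_left₀ hε0.ne', pow_mul, pow_mul]
    have e3 : ((k : ℝ) * (A * (l n ^ 2) ^ p)) ^ k = (k * A) ^ k * ((l n ^ 2) ^ p) ^ k := by
      rw [← mul_assoc, mul_pow]
    rw [e1, e3, ← e2]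
    ring
  have hupper : Tendsto (fun n => ((s n).card.choose k : ℝ) * Real.exp (-((l n + z) * k)) *
        Real.exp ((k : ℝ) ^ 2 * C * ((l n + z) / l n ^ 2)) +
      ((k : ℝ) * (A * (l n ^ 2) ^ p)) ^ k * Real.exp (-((l n + z) * ε)) *
        Real.exp (3 * (k : ℝ) ^ 2 * C * ((l n + z) / l n ^ 2)) *
        ∑ c ∈ Finset.range k, Real.exp (-z) ^ c) atTop
      (𝓝 (Real.exp (-z) ^ k / k.factorial)) := by
    have h := (hmain.mul (hexp ((k : ℝ) ^ 2 * C))).add ((hpoly.mul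
      (hexp (3 * (k : ℝ) ^ 2 * C))).mul_const (∑ c ∈ Finset.range k, Real.exp (-z) ^ c))
    rwa [mul_one, mul_one, zero_mul, add_zero] at h
  refine tendsto_of_tendsto_of_tendsto_of_le_of_le' hmain hupper ?_ ?_
  · filter_upwards [hlt.eventually_ge_atTop (-z)] with n hn
    rw [← Finset.card_powersetCard, ← nsmul_eq_mul]
    refine Finset.card_nsmul_le_sum _ _ _ fun T hT => Real.exp_le_exp.2 (neg_le_neg ?_)
    refine mul_le_mul_of_nonneg_left ?_ (by linarith)
    rw [← (Finset.mem_powersetCard.1 hT).2]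
    exact measureReal_biUnion_le_card h1 T
  · filter_upwards [hlt.eventually_ge_atTop (-z), hlt.eventually_ge_atTop 1,
      hcard.eventually_ge_atTop 1] with n hn hn1 hn2
    have hD : 1 ≤ l n ^ 2 := one_le_pow₀ hn1
    rw [← Finset.sum_filter_add_sum_filter_not _
      (fun T => ∀ x ∈ T, ∀ y ∈ T, x ≠ y → l n ^ 2 ≤ dist x y)]
    exact add_le_add
      (sum_separated_le hB h1 hC0 hC (by linarith) (s n) (by linarith) k)
      (sum_not_separated_le hB h1 hC0 hC hε (by linarith) (s n) (hs n)
        (fun x hx => hA n x hx _ hD) (Finset.card_pos.1 hn2) rfl (by linarith) k)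

end unitCover

/-! ### Packing bound for separated sets -/

/-- Volume comparison: the balls of radius `ρ / 2` around the points are disjoint and lie in a ball
of radius `D + ρ / 2`. The condition `1 ≤ D` lets the additive `1` be absorbed into the factor `D`.
-/
lemma card_filter_dist_le_of_separated {E : Type*} [NormedAddCommGroup E] [NormedSpace ℝ E]
    [FiniteDimensional ℝ E] {ρ : ℝ} (hρ : 0 < ρ) (s : Finset E)
    (hs : ∀ x ∈ s, ∀ y ∈ s, x ≠ y → ρ ≤ dist x y) (x : E) {D : ℝ} (hD : 1 ≤ D) :
    ((s.filter fun y => dist x y ≤ D).card : ℝ)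
      ≤ (2 / ρ + 1) ^ Module.finrank ℝ E * D ^ Module.finrank ℝ E := by
  borelize E
  set S := s.filter fun y => dist x y ≤ D with hS
  let μ : Measure E := Measure.addHaar
  have hr : 0 < ρ / 2 := by positivity
  have hR : 0 < D + ρ / 2 := by positivity
  have hdisj : (S : Set E).PairwiseDisjoint fun c => ball c (ρ / 2) := by
    intro a ha b hb hab
    apply ball_disjoint_ball
    rw [add_halves]
    exact hs a (Finset.mem_filter.1 ha).1 b (Finset.mem_filter.1 hb).1 hab
  have hsub : ⋃ c ∈ S, ball c (ρ / 2) ⊆ ball x (D + ρ / 2) := by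
    refine iUnion₂_subset fun c hc => ball_subset_ball' ?_
    have := (Finset.mem_filter.1 hc).2
    rw [dist_comm] at this
    linarith
  have hle : (S.card : ℝ≥0∞) * ENNReal.ofReal ((ρ / 2) ^ Module.finrank ℝ E)
      ≤ ENNReal.ofReal ((D + ρ / 2) ^ Module.finrank ℝ E) := by
    refine (ENNReal.mul_le_mul_iff_left (measure_ball_pos μ (0 : E) zero_lt_one).ne'
      measure_ball_lt_top.ne).1 ?_
    calc _ = μ (⋃ c ∈ S, ball c (ρ / 2)) := by
          rw [measure_biUnion_finset hdisj fun c _ => measurableSet_ball]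
          simp only [μ.addHaar_ball_of_pos _ hr, Finset.sum_const, nsmul_eq_mul, mul_assoc]
      _ ≤ μ (ball x (D + ρ / 2)) := measure_mono hsub
      _ = _ := μ.addHaar_ball_of_pos _ hR
  have h2 := ENNReal.toReal_le_of_le_ofReal (by positivity) hle
  rw [ENNReal.toReal_mul, ENNReal.toReal_natCast, ENNReal.toReal_ofReal (by positivity),
    ← le_div_iff₀ (by positivity), ← div_pow] at h2
  refine h2.trans ?_
  rw [← mul_pow]
  refine pow_le_pow_left₀ (by positivity) ?_ _
  rw [div_le_iff₀ hr]
  have : (2 / ρ + 1) * D * (ρ / 2) = D + D * (ρ / 2) := by field_simp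
  rw [this]
  nlinarith

/-! ### Time stamps and void probabilities -/

lemma measurableEmbedding_coe_nnreal : MeasurableEmbedding ((↑) : ℝ≥0 → ℝ) :=
  MeasurableEmbedding.subtype_coe measurableSet_Ici

instance sigmaFinite_timeMeasure : SigmaFinite timeMeasure := by
  have : IsFiniteMeasureOnCompacts timeMeasure :=
    IsFiniteMeasureOnCompacts.comap' _ NNReal.continuous_coe measurableEmbedding_coe_nnreal
  infer_instance

lemma timeMeasure_Iic (t : ℝ≥0) : timeMeasure (Iic t) = t := by
  have h : ((↑) : ℝ≥0 → ℝ) '' Iic t = Icc 0 (t : ℝ) := by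
    ext x
    constructor
    · rintro ⟨y, hy, rfl⟩
      exact ⟨y.2, hy⟩
    · rintro ⟨h0, h1⟩
      exact ⟨⟨x, h0⟩, h1, rfl⟩
  rw [timeMeasure, measurableEmbedding_coe_nnreal.comap_apply, h, Real.volume_Icc, sub_zero,
    ENNReal.ofReal_coe_nnreal]

lemma IsPoissonProcess.measurableSet_void {Ω E : Type*} [MeasurableSpace Ω] [MeasurableSpace E]
    {Ψ : Ω → Set E} {Λ : Measure E} {P : Measure Ω} (hΨ : IsPoissonProcess Ψ Λ P) {B : Set E}
    (hB : MeasurableSet B) : MeasurableSet {ω | Ψ ω ∩ B = ∅} := by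
  have h := hΨ.measurable_count B hB (measurableSet_singleton 0)
  have he : {ω | Ψ ω ∩ B = ∅} = (fun ω => (Ψ ω ∩ B).encard) ⁻¹' {0} := by
    ext ω
    simp only [mem_ofPred_eq, mem_preimage, mem_singleton_iff, encard_eq_zero]
  rw [he]
  exact h

/-- The void probabilities of a Poisson process. -/
lemma IsPoissonProcess.measureReal_void {Ω E : Type*} [MeasurableSpace Ω] [MeasurableSpace E]
    {Ψ : Ω → Set E} {Λ : Measure E} {P : Measure Ω} (hΨ : IsPoissonProcess Ψ Λ P) {B : Set E}
    (hB : MeasurableSet B) (hfin : Λ B < ∞) :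
    P.real {ω | Ψ ω ∩ B = ∅} = Real.exp (-Λ.real B) := by
  have he : {ω | Ψ ω ∩ B = ∅} = (fun ω => (Ψ ω ∩ B).encard) ⁻¹' {0} := by
    ext ω
    simp only [mem_ofPred_eq, mem_preimage, mem_singleton_iff, encard_eq_zero]
  have h0 : (fun k : ℕ => (k : ℕ∞)) ⁻¹' {0} = {0} := by
    ext k
    simp
  rw [he, measureReal_def, ← Measure.map_apply (hΨ.measurable_count B hB)
    (measurableSet_singleton _), hΨ.map_count B hB hfin,
    Measure.map_apply measurable_from_top (measurableSet_singleton _), h0, ← measureReal_def,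
    poissonMeasure_real_singleton]
  simp [measureReal_def, ENNReal.toReal]

/-! ### Cover times of finite sets -/

section coverTime

variable {d : ℕ}

/-- Every point of `s` is covered by the cylinders with time stamp at most `t`. -/
def IsCoveredAt (ψ : Set (Line d × ℝ≥0)) (s : Finset (Space d)) (t : ℝ≥0) : Prop :=
  ∀ x ∈ s, (ψ ∩ ballLines x ×ˢ Iic t) ≠ ∅

lemma subset_iUnion_cylinder_iff (ψ : Set (Line d × ℝ≥0)) (s : Finset (Space d)) (t : ℝ≥0) :
    ((s : Set (Space d)) ⊆ ⋃ p ∈ {p ∈ ψ | p.2 ≤ t}, cylinder p.1) ↔ IsCoveredAt ψ s t := by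
  refine forall₂_congr fun x _ => ?_
  rw [mem_iUnion₂, ← nonempty_iff_ne_empty]
  constructor
  · rintro ⟨p, ⟨hp, hpt⟩, hx⟩
    exact ⟨p, hp, mem_cylinder_iff.1 hx, hpt⟩
  · rintro ⟨p, hp, hx, hpt⟩
    exact ⟨p, ⟨hp, hpt⟩, mem_cylinder_iff.2 hx⟩

lemma IsCoveredAt.mono {ψ : Set (Line d × ℝ≥0)} {s : Finset (Space d)} {t t' : ℝ≥0}
    (h : IsCoveredAt ψ s t) (htt' : t ≤ t') : IsCoveredAt ψ s t' := fun x hx =>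
  (nonempty_iff_ne_empty.2 (h x hx)).mono
    (inter_subset_inter_right _ (prod_mono subset_rfl (Iic_subset_Iic.2 htt'))) |>.ne_empty

lemma coverTime_lt_iff {ψ : Set (Line d × ℝ≥0)} {s : Finset (Space d)} {a : ℝ≥0∞} :
    coverTime ψ s < a ↔ ∃ t : ℝ≥0, 0 < t ∧ IsCoveredAt ψ s t ∧ (t : ℝ≥0∞) < a := by
  simp only [coverTime, iInf_lt_iff, subset_iUnion_cylinder_iff, exists_prop]

/-- Being covered is monotone in time, so rational times suffice; this makes the cover time
measurable. -/
lemma coverTime_lt_iff_rat {ψ : Set (Line d × ℝ≥0)} {s : Finset (Space d)} {a : ℝ≥0∞} :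
    coverTime ψ s < a ↔ ∃ q : ℚ, 0 < Real.toNNReal q ∧ IsCoveredAt ψ s (Real.toNNReal q) ∧
      (Real.toNNReal q : ℝ≥0∞) < a := by
  rw [coverTime_lt_iff]
  constructor
  · rintro ⟨t, ht0, ht, hta⟩
    obtain ⟨q, -, htq, hqa⟩ := ENNReal.lt_iff_exists_rat_btwn.1 hta
    rw [ENNReal.coe_lt_coe] at htq
    exact ⟨q, ht0.trans htq, ht.mono htq.le, hqa⟩
  · rintro ⟨q, h0, hq, hqa⟩
    exact ⟨_, h0, hq, hqa⟩

lemma coverTime_le_of_isCoveredAt {ψ : Set (Line d × ℝ≥0)} {s : Finset (Space d)} {t : ℝ≥0}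
    (ht0 : 0 < t) (h : IsCoveredAt ψ s t) : coverTime ψ s ≤ t :=
  iInf₂_le_of_le t ht0 (iInf_le_of_le ((subset_iUnion_cylinder_iff _ _ _).2 h) le_rfl)

lemma measurableSet_ballLines_prod_Iic (x : Space d) (t : ℝ≥0) :
    MeasurableSet (ballLines x ×ˢ Iic t : Set (Line d × ℝ≥0)) :=
  (measurableSet_ballLines x).prod measurableSet_Iic

variable {Ω : Type*} [MeasurableSpace Ω] {P : Measure Ω} {Ψ : Ω → Set (Line d × ℝ≥0)}

lemma setOf_isCoveredAt_eq {Ω : Type*} {Ψ : Ω → Set (Line d × ℝ≥0)} (s : Finset (Space d)) (t : ℝ≥0) :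
    {ω | IsCoveredAt (Ψ ω) s t}
      = ⋂ x ∈ s, {ω | Ψ ω ∩ ballLines x ×ˢ Iic t = ∅}ᶜ := by
  ext ω
  simp [IsCoveredAt]

lemma measurableSet_isCoveredAt (hΨ : IsCylinderProcess Ψ P) (s : Finset (Space d)) (t : ℝ≥0) :
    MeasurableSet {ω | IsCoveredAt (Ψ ω) s t} := by
  rw [setOf_isCoveredAt_eq]
  exact Finset.measurableSet_biInter _ fun x _ =>
    (hΨ.measurableSet_void (measurableSet_ballLines_prod_Iic x t)).compl

lemma measurable_coverTime (hΨ : IsCylinderProcess Ψ P) (s : Finset (Space d)) :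
    Measurable fun ω => coverTime (Ψ ω) (s : Set (Space d)) := by
  refine measurable_of_Iio fun a => ?_
  have : (fun ω => coverTime (Ψ ω) (s : Set (Space d))) ⁻¹' Iio a
      = ⋃ q : ℚ, {ω | 0 < Real.toNNReal q ∧ IsCoveredAt (Ψ ω) s (Real.toNNReal q) ∧
        (Real.toNNReal q : ℝ≥0∞) < a} := by
    ext ω
    simp only [mem_preimage, mem_Iio, coverTime_lt_iff_rat, mem_iUnion, mem_ofPred_eq]
  rw [this]
  exact MeasurableSet.iUnion fun q => (MeasurableSet.const _).inter
    ((measurableSet_isCoveredAt hΨ s _).inter (MeasurableSet.const _))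

/-- The probability that all points of `T` are uncovered at time `t`. -/
lemma measureReal_iInter_void (hd : 2 ≤ d) (hΨ : IsCylinderProcess Ψ P) (T : Finset (Space d))
    (t : ℝ≥0) :
    P.real (⋂ x ∈ T, {ω | Ψ ω ∩ ballLines x ×ˢ Iic t = ∅})
      = Real.exp (-(t * (lineMeasure d).real (⋃ x ∈ T, ballLines x))) := by
  have hset : ⋂ x ∈ T, {ω | Ψ ω ∩ ballLines x ×ˢ Iic t = ∅}
      = {ω | Ψ ω ∩ (⋃ x ∈ T, ballLines x) ×ˢ Iic t = ∅} := by
    ext ω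
    simp only [mem_iInter, mem_ofPred_eq, iUnion_prod_const, inter_iUnion, iUnion_eq_empty]
  have hval : (lineMeasure d).prod timeMeasure ((⋃ x ∈ T, ballLines x) ×ˢ Iic t)
      = lineMeasure d (⋃ x ∈ T, ballLines x) * t := by
    rw [Measure.prod_prod, timeMeasure_Iic]
  have hfin := measure_biUnion_ne_top (lineMeasure_ballLines hd) T
  rw [hset, hΨ.measureReal_void ((Finset.measurableSet_biUnion _ fun x _ =>
    measurableSet_ballLines x).prod measurableSet_Iic)
    (by rw [hval]; exact ENNReal.mul_lt_top hfin.lt_top ENNReal.coe_lt_top),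
    measureReal_def, hval, ENNReal.toReal_mul, ENNReal.coe_toReal, mul_comm, measureReal_def]

/-- Union bound over single points, each uncovered with probability `exp (-t)`. It yields almost
sure finiteness as `t → ∞`. -/
lemma measureReal_not_isCoveredAt_le [IsProbabilityMeasure P] (hd : 2 ≤ d)
    (hΨ : IsCylinderProcess Ψ P) (s : Finset (Space d)) (t : ℝ≥0) :
    P.real {ω | IsCoveredAt (Ψ ω) s t}ᶜ ≤ s.card * Real.exp (-t) := by
  rw [setOf_isCoveredAt_eq, compl_iInter₂]
  simp_rw [compl_compl]
  refine (measureReal_biUnion_finset_le _ _).trans ?_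
  rw [← nsmul_eq_mul]
  refine Finset.sum_le_card_nsmul _ _ _ fun x _ => le_of_eq ?_
  have h := measureReal_iInter_void hd hΨ {x} t
  simp only [Finset.mem_singleton, iInter_iInter_eq_left, iUnion_iUnion_eq_left] at h
  rw [h, measureReal_def, lineMeasure_ballLines hd, ENNReal.toReal_one, mul_one]

lemma ae_coverTime_lt_top [IsProbabilityMeasure P] (hd : 2 ≤ d) (hΨ : IsCylinderProcess Ψ P)
    (s : Finset (Space d)) : ∀ᵐ ω ∂P, coverTime (Ψ ω) (s : Set (Space d)) < ∞ := by
  have hle : ∀ n : ℕ, P.real {ω | ¬ coverTime (Ψ ω) (s : Set (Space d)) < ∞}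
      ≤ s.card * Real.exp (-((n : ℝ) + 1)) := by
    intro n
    refine le_trans (measureReal_mono (s₂ := {ω | IsCoveredAt (Ψ ω) s (n + 1)}ᶜ)
      fun ω hω hcov => hω ?_)
      ((measureReal_not_isCoveredAt_le hd hΨ s (n + 1)).trans_eq (by push_cast; rfl))
    exact coverTime_lt_iff.2 ⟨n + 1, by positivity, hcov, ENNReal.coe_lt_top⟩
  have hlim : Tendsto (fun n : ℕ => (s.card : ℝ) * Real.exp (-((n : ℝ) + 1))) atTop (𝓝 0) := by
    have h := (Real.tendsto_exp_neg_atTop_nhds_zero.comp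
      (tendsto_atTop_add_const_right _ (1 : ℝ) tendsto_natCast_atTop_atTop)).const_mul (s.card : ℝ)
    rwa [mul_zero] at h
  have h0 : P.real {ω | ¬ coverTime (Ψ ω) (s : Set (Space d)) < ∞} = 0 :=
    le_antisymm (ge_of_tendsto' hlim hle) measureReal_nonneg
  rw [ae_iff]
  exact (measureReal_eq_zero_iff (measure_ne_top _ _)).1 h0

/-- The probability that `s n` is covered at time `log |s n| + z` converges to the Gumbel
distribution function, for separated sets `s n` with `|s n| → ∞`. -/
lemma tendsto_measureReal_isCoveredAt [IsProbabilityMeasure P] (hd : 2 ≤ d)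
    (hΨ : IsCylinderProcess Ψ P) {ρ : ℝ} (hρ : 0 < ρ) (s : ℕ → Finset (Space d))
    (hs : ∀ n, ∀ x ∈ s n, ∀ y ∈ s n, x ≠ y → ρ ≤ dist x y)
    (hcard : Tendsto (fun n => (s n).card) atTop atTop) (z : ℝ) :
    Tendsto (fun n => P.real {ω | IsCoveredAt (Ψ ω) (s n) (Real.log (s n).card + z).toNNReal})
      atTop (𝓝 (Real.exp (-Real.exp (-z)))) := by
  obtain ⟨C, hC0, hC⟩ := exists_lineMeasure_inter_le hd
  obtain ⟨ε, hε0, hε⟩ := exists_le_lineMeasure_diff hd hρ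
  refine tendsto_exp_neg_of_binomial_moments (S := fun n k => ∑ T ∈ (s n).powersetCard k,
    P.real (⋂ x ∈ T, {ω | Ψ ω ∩ ballLines x ×ˢ Iic (Real.log (s n).card + z).toNNReal = ∅}))
    (fun n K => ?_) fun k => ?_
  · rw [setOf_isCoveredAt_eq]
    exact bonferroni P (s n) _ (fun x _ =>
      hΨ.measurableSet_void (measurableSet_ballLines_prod_Iic x _)) K
  · have h := tendsto_sum_exp_neg_measureReal measurableSet_ballLines (lineMeasure_ballLines hd)
      hC0 hC hε0 hε s hs (fun n x _ D hD => card_filter_dist_le_of_separated hρ (s n) (hs n) x hD)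
      hcard z k
    refine h.congr' ?_
    have hlt : Tendsto (fun n => Real.log (s n).card) atTop atTop :=
      Real.tendsto_log_atTop.comp (tendsto_natCast_atTop_atTop.comp hcard)
    -- The truncation by `toNNReal` is inactive once `log |s n| + z ≥ 0`.
    filter_upwards [hlt.eventually_ge_atTop (-z)] with n hn
    refine Finset.sum_congr rfl fun T _ => ?_
    rw [measureReal_iInter_void hd hΨ, Real.coe_toNNReal _ (by linarith)]

/-- Whether the infimum defining the cover time is attained is not decided. Instead the event is
squeezed between coverage at level `z` and at level `z + δ`, and continuity of the limit in `z`
removes `δ`. -/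
lemma tendsto_measureReal_coverTime_le [IsProbabilityMeasure P] (hd : 2 ≤ d)
    (hΨ : IsCylinderProcess Ψ P) {ρ : ℝ} (hρ : 0 < ρ) (s : ℕ → Finset (Space d))
    (hs : ∀ n, ∀ x ∈ s n, ∀ y ∈ s n, x ≠ y → ρ ≤ dist x y)
    (hcard : Tendsto (fun n => (s n).card) atTop atTop) (z : ℝ) :
    Tendsto (fun n => P.real {ω | (coverTime (Ψ ω) (s n : Set (Space d))).toReal
        - Real.log (s n).card ≤ z})
      atTop (𝓝 (Real.exp (-Real.exp (-z)))) := by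
  have hlt : Tendsto (fun n => Real.log (s n).card) atTop atTop :=
    Real.tendsto_log_atTop.comp (tendsto_natCast_atTop_atTop.comp hcard)
  have hlower : ∀ᶠ n in atTop,
      P.real {ω | IsCoveredAt (Ψ ω) (s n) (Real.log (s n).card + z).toNNReal}
      ≤ P.real {ω | (coverTime (Ψ ω) (s n : Set (Space d))).toReal
        - Real.log (s n).card ≤ z} := by
    filter_upwards [hlt.eventually_gt_atTop (-z)] with n hn
    refine measureReal_mono fun ω hω => ?_
    have hpos : 0 < Real.log (s n).card + z := by linarith
    have h := ENNReal.toReal_mono ENNReal.coe_ne_top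
      (coverTime_le_of_isCoveredAt (Real.toNNReal_pos.2 hpos) hω)
    rw [ENNReal.coe_toReal, Real.coe_toNNReal _ hpos.le] at h
    rw [mem_ofPred_eq]
    linarith
  have hupper : ∀ δ > 0, ∀ n, P.real {ω | (coverTime (Ψ ω) (s n : Set (Space d))).toReal
        - Real.log (s n).card ≤ z}
      ≤ P.real {ω | IsCoveredAt (Ψ ω) (s n) (Real.log (s n).card + (z + δ)).toNNReal} := by
    intro δ hδ n
    refine ENNReal.toReal_mono (measure_ne_top _ _) (measure_mono_ae ?_)
    -- Finiteness must be known here, because an infinite cover time would have `toReal` equal to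
    -- `0`.
    filter_upwards [ae_coverTime_lt_top hd hΨ (s n)] with ω hω h
    have h' : (coverTime (Ψ ω) (s n : Set (Space d))).toReal - Real.log (s n).card ≤ z := h
    have h0 : 0 ≤ (coverTime (Ψ ω) (s n : Set (Space d))).toReal := ENNReal.toReal_nonneg
    have hlt' : coverTime (Ψ ω) (s n : Set (Space d))
        < ENNReal.ofReal (Real.log (s n).card + (z + δ)) := by
      rw [ENNReal.lt_ofReal_iff_toReal_lt hω.ne]
      linarith
    obtain ⟨t, -, ht, hta⟩ := coverTime_lt_iff.1 hlt'
    exact ht.mono (ENNReal.coe_le_coe.1 hta.le)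
  rw [tendsto_order]
  constructor
  · intro a ha
    filter_upwards [hlower, (tendsto_order.1
      (tendsto_measureReal_isCoveredAt hd hΨ hρ s hs hcard z)).1 a ha] with n h1 h2
    exact h2.trans_le h1
  · intro a ha
    have hcont : Tendsto (fun δ => Real.exp (-Real.exp (-(z + δ)))) (𝓝[>] 0)
        (𝓝 (Real.exp (-Real.exp (-z)))) := by
      have : Continuous fun δ => Real.exp (-Real.exp (-(z + δ))) := by fun_prop
      simpa using (this.tendsto 0).mono_left nhdsWithin_le_nhds
    obtain ⟨δ, hδa, hδ⟩ := (((tendsto_order.1 hcont).2 a ha).and self_mem_nhdsWithin).exists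
    filter_upwards [(tendsto_order.1
      (tendsto_measureReal_isCoveredAt hd hΨ hρ s hs hcard (z + δ))).2 a hδa] with n hn
    exact (hupper δ hδ n).trans_lt hn

end coverTime

/-! ### The Gumbel limit -/

lemma measureReal_gumbel_Iic (z : ℝ) : gumbel.real (Iic z) = Real.exp (-Real.exp (-z)) := by
  have h : Tendsto gumbelCDF atBot (𝓝 0) :=
    Real.tendsto_exp_atBot.comp (tendsto_neg_atTop_atBot.comp
      (Real.tendsto_exp_atTop.comp tendsto_neg_atBot_atTop))
  rw [measureReal_def, gumbel, gumbelCDF.measure_Iic h, sub_zero]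
  exact ENNReal.toReal_ofReal (Real.exp_pos _).le

end PoissonCylinder

end

theorem theorem1p2 (d : ℕ) (hd : 2 ≤ d) (ρ : ℝ) (hρ_pos : 0 < ρ)
    (hρ : ρ < min (((d : ℝ) - 1) / (6 * (d : ℝ))) (PoissonCylinder.constC d / 5))
    (R : Set (PoissonCylinder.Space d) → Finset (PoissonCylinder.Space d))
    (hR : PoissonCylinder.IsSelectionRule ρ R)
    {Ω : Type*} [MeasurableSpace Ω] (P : Measure Ω) [IsProbabilityMeasure P]
    (Ψ : Ω → Set (PoissonCylinder.Line d × ℝ≥0)) (hΨ : PoissonCylinder.IsCylinderProcess Ψ P)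
    (A : ℕ → Set (PoissonCylinder.Space d)) (hA : ∀ n, Bornology.IsBounded (A n))
    (hcard : Tendsto (fun n => (R (A n)).card) atTop atTop) :
    (∀ n, ∀ᵐ ω ∂P, PoissonCylinder.discreteCoverTime R (Ψ ω) (A n) < ∞) ∧
    TendstoInDistribution
      (fun n ω => (PoissonCylinder.discreteCoverTime R (Ψ ω) (A n)).toReal
        - Real.log ((R (A n)).card : ℝ))
      atTop (id : ℝ → ℝ) (fun _ => P) PoissonCylinder.gumbel := by
  have hmeas : ∀ n, Measurable fun ω =>
      (PoissonCylinder.discreteCoverTime R (Ψ ω) (A n)).toReal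
        - Real.log ((R (A n)).card : ℝ) := fun n =>
    (PoissonCylinder.measurable_coverTime hΨ (R (A n))).ennreal_toReal.sub_const _
  refine ⟨fun n => PoissonCylinder.ae_coverTime_lt_top hd hΨ (R (A n)),
    fun n => (hmeas n).aemeasurable, aemeasurable_id, ?_⟩
  refine PoissonCylinder.tendsto_probabilityMeasure_of_tendsto_Iic fun z => ?_
  have h := PoissonCylinder.tendsto_measureReal_coverTime_le hd hΨ hρ_pos (fun n => R (A n))
    (fun n => (hR (A n) (hA n)).1.2) hcard z
  rw [← PoissonCylinder.measureReal_gumbel_Iic] at h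
  simp only [ProbabilityMeasure.coe_mk, Measure.map_id]
  refine h.congr fun n => ?_
  rw [map_measureReal_apply (hmeas n) measurableSet_Iic]
  rfl
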